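/- Let $n$ be a natural number, let $E/F$ be an unramified quadratic extension of non-archimedean local fields of characteristic different from $2$, with Galois involution $\tau$, and let $\pi$ be a uniformizer of $F$ (hence also of $E$). Let $G=SL_n(E)$ and $K_0=SL_n(\mathcal O_E)$, and let $G$ act on $X=\{x\in SL_n(E) : \tau(x^t)=x\}$ by $g\cdot x=g\,x\,\tau(g^t)$. Fix a Haar measure $dg$ on $G$. Let $A=\mathcal H(G,K_0)$ be the space of locally constant, compactly supported, $K_0$-bi-invariant functions $G\to\mathbb C$, with the convolution product, and let $M=\mathcal S(X)^{K_0}$ be the space of locally constant, compactly supported, $K_0$-invariant functions $X\to\mathbb C$, on which $A$ acts by $(f\phi)(x)=\int_G f(g)\,\phi(g^{-1}\cdot x)\,dg$. Let $\Lambda=\{\lambda\in\mathbb Z^n : \lambda_1+\dots+\lambda_n=0\}$ and $\Lambda^{++}=\{\lambda\in\Lambda : \lambda_1\ge\dots\ge\lambda_n\}$. For $\lambda,\lambda'\in\Lambda$ write $\lambda'<\lambda$ if $\lambda'\neq\lambda$ and $\sum_{i\le k}(\lambda_i-\lambda'_i)\ge 0$ for all $k=1,\dots,n$. For $\lambda\in\Lambda$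 let $\pi^\lambda=\mathrm{diag}(\pi^{\lambda_1},\dots,\pi^{\lambda_n})\in G$ and let $x_\lambda$ be the same matrix viewed as a point of $X$; let $a_\lambda$ be the characteristic function of $K_0\pi^\lambda K_0$ and $m_\lambda$ the characteristic function of $K_0\cdot x_\lambda$. Let $F_{<\lambda}(A)$ be the span of the $a_\nu$, and $G_{<\lambda}(M)$ the span of the $m_\nu$, over all $\nu\in\Lambda^{++}$ with $\nu<\lambda$. Let $\lambda,\mu\in\Lambda^{++}$. Then $a_\lambda\in A$, $m_\mu\in M$, and: 1. there are a non-zero $p(\lambda,\mu)\in\mathbb C$ and $r\in F_{<\lambda+\mu}(A)$ such that $a_\lambda a_\mu=p(\lambda,\mu)\,a_{\lambda+\mu}+r$; 2. there are a non-zero $q(\lambda,\mu)\in\mathbb C$ and $\delta\in G_{<2\lambda+\mu}(M)$ such that $a_\lambda m_\mu=q(\lambda,\mu)\,m_{2\lambda+\mu}+\delta$. -/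

import Mathlib

open scoped ValuativeRel MatrixGroups
open MeasureTheory

noncomputable section

namespace HermitianHecke

section LocalFields

/-- `ϖ` is a uniformizer of the local field `K`: an irreducible element of the discrete valuation
ring `𝒪[K]`. -/
def IsUniformizer {K : Type*} [Field K] [ValuativeRel K] (ϖ : K) : Prop :=
  ∃ h : ϖ ∈ 𝒪[K], Irreducible (⟨ϖ, h⟩ : 𝒪[K])

/-- The extension `E / F` of non-archimedean local fields is unramified: the ramification index is
one, i.e. uniformizers of `F` are uniformizers of `E`. (The residue fields are finite, so the
residue field extension is separable.) -/
def IsUnramifiedExtension (F E : Type*) [Field F] [ValuativeRel F] [Field E] [ValuativeRel E]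
    [Algebra F E] : Prop :=
  ∀ ϖ : F, IsUniformizer ϖ → IsUniformizer (algebraMap F E ϖ)

end LocalFields

section Coweights

/-- The lattice `Λ = {(λ₁, …, λₙ) ∈ ℤⁿ | λ₁ + ⋯ + λₙ = 0}`. -/
def CoweightLattice (n : ℕ) : AddSubgroup (Fin n → ℤ) where
  carrier := {l | ∑ i, l i = 0}
  zero_mem' := by simp
  add_mem' := by
    intro a b ha hb
    simp only [Set.mem_ofPred_eq] at ha hb ⊢
    simp [Finset.sum_add_distrib, ha, hb]
  neg_mem' := by
    intro a ha
    simp only [Set.mem_ofPred_eq] at ha ⊢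
    simp [ha]

/-- `λ ∈ Λ⁺⁺`: `λ₁ ≥ λ₂ ≥ ⋯ ≥ λₙ`. -/
def IsDominant {n : ℕ} (l : CoweightLattice n) : Prop := Antitone l.1

/-- `λ ∈ Λ⁺`: all partial sums `λ₁ + ⋯ + λₖ` are non-negative. -/
def IsPositive {n : ℕ} (l : CoweightLattice n) : Prop :=
  ∀ k : Fin n, 0 ≤ ∑ i ∈ Finset.Iic k, l.1 i

/-- The strict dominance order `l' < l`: `l - l' ∈ Λ⁺` and `l ≠ l'`. -/
def DomLT {n : ℕ} (l' l : CoweightLattice n) : Prop := IsPositive (l - l') ∧ l' ≠ l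

end Coweights

section Spaces

/-- The Galois involution of a quadratic extension `E / F`: a nontrivial `F`-automorphism of `E` of
order two. -/
structure GaloisInvolution (F E : Type*) [Field F] [Field E] [Algebra F E] where
  toAlgEquiv : E ≃ₐ[F] E
  involutive : ∀ x, toAlgEquiv (toAlgEquiv x) = x
  ne_one : toAlgEquiv ≠ 1

/-- `K₀ = SL(n, 𝒪_E)` as a subgroup of `SL(n, E)`. -/
def K₀ (n : ℕ) (E : Type*) [Field E] [ValuativeRel E] : Subgroup SL(n, E) :=
  (Matrix.SpecialLinearGroup.map (n := Fin n) (𝒪[E]).subtype).range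

variable {F E : Type*} [Field F] [Field E] [Algebra F E] {n : ℕ}

/-- The conjugate transpose `τ(gᵗ)` of `g ∈ SL(n, E)`. -/
def conjTr (τ : GaloisInvolution F E) (g : SL(n, E)) : SL(n, E) :=
  Matrix.SpecialLinearGroup.map (τ.toAlgEquiv : E →+* E) g.transpose

lemma conjTr_mul (τ : GaloisInvolution F E) (g h : SL(n, E)) :
    conjTr τ (g * h) = conjTr τ h * conjTr τ g := by
  unfold conjTr
  rw [← map_mul]
  congr 1
  apply Subtype.ext
  exact Matrix.transpose_mul _ _

lemma conjTr_one (τ : GaloisInvolution F E) : conjTr τ (1 : SL(n, E)) = 1 := by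
  unfold conjTr
  rw [show (1 : SL(n, E)).transpose = 1 from Subtype.ext Matrix.transpose_one, map_one]

lemma conjTr_conjTr (τ : GaloisInvolution F E) (g : SL(n, E)) : conjTr τ (conjTr τ g) = g := by
  ext i j
  exact τ.involutive _

variable (n) in
/-- The space `X(F) = {x ∈ SL(n, E) | τ(xᵗ) = x}` of Hermitian matrices of determinant one. -/
def HermSpace (τ : GaloisInvolution F E) : Type _ := {x : SL(n, E) // conjTr τ x = x}

instance [TopologicalSpace E] (τ : GaloisInvolution F E) : TopologicalSpace (HermSpace n τ) :=
  inferInstanceAs (TopologicalSpace {x : SL(n, E) // conjTr τ x = x})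

/-- The action `g • x = g x τ(gᵗ)` of `SL(n, E)` on `X(F)`. -/
instance (τ : GaloisInvolution F E) : MulAction SL(n, E) (HermSpace n τ) where
  smul g x := ⟨g * x.1 * conjTr τ g, by
    rw [conjTr_mul, conjTr_mul, conjTr_conjTr, x.2, mul_assoc]⟩
  one_smul x := Subtype.ext <| by
    change 1 * x.1 * conjTr τ 1 = x.1
    rw [conjTr_one, one_mul, mul_one]
  mul_smul g h x := Subtype.ext <| by
    change g * h * x.1 * conjTr τ (g * h) = g * (h * x.1 * conjTr τ h) * conjTr τ g
    rw [conjTr_mul]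
    simp only [mul_assoc]

variable (E) in
/-- `π^λ = diag(π^{λ₁}, …, π^{λₙ}) ∈ SL(n, E)`, for `π` in `F`. -/
def piPow (ϖ : Fˣ) (l : CoweightLattice n) : SL(n, E) :=
  ⟨Matrix.diagonal fun i => algebraMap F E (ϖ : F) ^ l.1 i, by
    have h0 : algebraMap F E (ϖ : F) ≠ 0 := by simp
    have hsum : ∀ s : Finset (Fin n), ∏ i ∈ s, algebraMap F E (ϖ : F) ^ l.1 i
        = algebraMap F E (ϖ : F) ^ (∑ i ∈ s, l.1 i) := by
      intro s
      induction s using Finset.cons_induction with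
      | empty => simp
      | cons a s ha ih => rw [Finset.prod_cons, Finset.sum_cons, zpow_add₀ h0, ih]
    rw [Matrix.det_diagonal, hsum, show ∑ i, l.1 i = 0 from l.2, zpow_zero]⟩

/-- `x_λ`: the matrix `π^λ` regarded as a point of `X(F)`. -/
def xPt (τ : GaloisInvolution F E) (ϖ : Fˣ) (l : CoweightLattice n) : HermSpace n τ :=
  ⟨piPow E ϖ l, by
    ext i j
    change τ.toAlgEquiv (Matrix.diagonal (fun i => algebraMap F E (ϖ : F) ^ l.1 i) j i)
      = Matrix.diagonal (fun i => algebraMap F E (ϖ : F) ^ l.1 i) i j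
    by_cases h : i = j
    · subst h
      simp [map_zpow₀]
    · simp [Matrix.diagonal_apply_ne _ h, Matrix.diagonal_apply_ne' _ h]⟩

end Spaces

section Hecke

variable {G : Type*} [Group G] [TopologicalSpace G]

/-- The underlying space of the Hecke algebra `H(G, K)`: locally constant compactly supported
`K`-biinvariant functions on `G`. -/
def heckeAlgebra (K : Subgroup G) : Submodule ℂ (G → ℂ) where
  carrier := {f | IsLocallyConstant f ∧ HasCompactSupport f ∧
    (∀ k ∈ K, ∀ g, f (k * g) = f g) ∧ ∀ k ∈ K, ∀ g, f (g * k) = f g}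
  zero_mem' := ⟨IsLocallyConstant.const 0, HasCompactSupport.zero, by simp, by simp⟩
  add_mem' := by
    rintro a b ⟨h1, h2, h3, h4⟩ ⟨h1', h2', h3', h4'⟩
    exact ⟨h1.add h1', h2.add h2', fun k hk g => by simp [h3 k hk, h3' k hk],
      fun k hk g => by simp [h4 k hk, h4' k hk]⟩
  smul_mem' := by
    rintro c a ⟨h1, h2, h3, h4⟩
    exact ⟨h1.comp (fun z => c • z), h2.smul_left (f := fun _ => c),
      fun k hk g => by simp [h3 k hk], fun k hk g => by simp [h4 k hk]⟩

/-- The space `S(X)^K`: locally constant compactly supported `K`-invariant functions on `X`. -/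
def schwartzInv {X : Type*} [TopologicalSpace X] [MulAction G X] (K : Subgroup G) :
    Submodule ℂ (X → ℂ) where
  carrier := {f | IsLocallyConstant f ∧ HasCompactSupport f ∧ ∀ k ∈ K, ∀ x, f (k • x) = f x}
  zero_mem' := ⟨IsLocallyConstant.const 0, HasCompactSupport.zero, by simp⟩
  add_mem' := by
    rintro a b ⟨h1, h2, h3⟩ ⟨h1', h2', h3'⟩
    exact ⟨h1.add h1', h2.add h2', fun k hk g => by simp [h3 k hk, h3' k hk]⟩
  smul_mem' := by
    rintro c a ⟨h1, h2, h3⟩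
    exact ⟨h1.comp (fun z => c • z), h2.smul_left (f := fun _ => c),
      fun k hk g => by simp [h3 k hk]⟩

/-- Convolution `(f * φ)(x) = ∫ f(g) φ(g⁻¹ x) dν(g)`. For `X = G` with left translation this is the
product of the Hecke algebra; in general it is the action of the Hecke algebra on `S(X)^K`. -/
def conv [MeasurableSpace G] {X : Type*} [MulAction G X] (ν : Measure G) (f : G → ℂ) (φ : X → ℂ) :
    X → ℂ :=
  fun x => ∫ g, f g * φ (g⁻¹ • x) ∂ν

end Hecke

section Basis

variable {F E : Type*} [Field F] [Field E] [Algebra F E] [ValuativeRel E] {n : ℕ}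

variable (E) in
/-- `a_λ`: the characteristic function of the double coset `K₀ π^λ K₀`. -/
def aFun (ϖ : Fˣ) (l : CoweightLattice n) : SL(n, E) → ℂ :=
  (DoubleCoset.doubleCoset (piPow E ϖ l) (K₀ n E : Set SL(n, E)) (K₀ n E)).indicator 1

/-- `m_λ`: the characteristic function of the orbit `K₀ • x_λ`. -/
def mFun (τ : GaloisInvolution F E) (ϖ : Fˣ) (l : CoweightLattice n) : HermSpace n τ → ℂ :=
  (MulAction.orbit (K₀ n E) (xPt τ ϖ l)).indicator 1

variable (E) in
/-- `F_{<λ}(A)`: the span of the `a_μ` with `μ` dominant and `μ < λ`. -/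
def filtA (ϖ : Fˣ) (l : CoweightLattice n) : Submodule ℂ (SL(n, E) → ℂ) :=
  Submodule.span ℂ {f | ∃ m : CoweightLattice n, IsDominant m ∧ DomLT m l ∧ f = aFun E ϖ m}

/-- `G_{<λ}(M)`: the span of the `m_μ` with `μ` dominant and `μ < λ`. -/
def filtM (τ : GaloisInvolution F E) (ϖ : Fˣ) (l : CoweightLattice n) :
    Submodule ℂ (HermSpace n τ → ℂ) :=
  Submodule.span ℂ {f | ∃ m : CoweightLattice n, IsDominant m ∧ DomLT m l ∧ f = mFun τ ϖ m}

end Basis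

end HermitianHecke

end

/-! For $Y$ stable under $K_0$, the value at $x$ of the convolution of the characteristic functions
of $K_0\pi^\lambda K_0$ and $Y$ is the Haar measure of the set of $g\in K_0\pi^\lambda K_0$ with
$g^{-1}\cdot x\in Y$. This set is open and lies in a compact set, so the value is non-zero exactly
when the set is non-empty (`conv_indicator_ne_zero_iff`). No coefficient has to be computed: both
statements reduce to locating supports.

The supports are unions of the pieces indexed by $\Lambda^{++}$. For $G$ these are the double cosets
of the Cartan decomposition (`exists_cartan`). For $X$ one shows that every $K_0$-orbit contains
some dominant $x_\lambda$ (`IsUnramifiedInvolution.exists_normalForm`). This is where unramifiedness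
enters: the trace takes a unit value on $\mathcal O_E$, so a diagonal pivot can be created, and
every $\tau$-fixed unit is a norm, so diagonal units can be removed. Uniqueness follows from that
for $G$, since the orbit of $x_\lambda$ is the trace of $K_0\pi^\lambda K_0$ on $X$
(`mem_orbit_iff`).

Dominance is read off from minors. Left multiplication by an element of $K_0\pi^\lambda K_0$ scales
bounds on $k\times k$ minors by at most $|\pi|$ to the power of the sum of the last $k$ entries of
$\lambda$. These factors multiply, so a product of elements of $K_0\pi^\lambda K_0$ and $K_0\pi^\mu
K_0$ has type at most $\lambda+\mu$, and $g\,y\,\tau(g^t)$ has type at most $2\lambda+\mu$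
(`isPositive_sub_of_minorBound`). Only finitely many dominant weights lie below a given one, and the
leading coefficient is non-zero because $g=\pi^\lambda$ contributes. -/

noncomputable section

namespace HermitianHecke

open ValuativeRel

set_option linter.unusedSectionVars false

/-! ### Uniformizers and the topology of a local field. -/

section Uniformizer

variable {K : Type*} [Field K] [ValuativeRel K]

lemma IsUniformizer.valuation_lt_one {p : K} (hp : IsUniformizer p) : valuation K p < 1 := by
  obtain ⟨h, hi⟩ := hp
  have h1 : valuation K p ≤ 1 := h
  refine lt_of_le_of_ne h1 fun h2 => hi.not_isUnit ?_
  exact (Valuation.integer.integers (valuation K)).isUnit_iff_valuation_eq_one.2 h2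

lemma IsUniformizer.ne_zero {p : K} (hp : IsUniformizer p) : p ≠ 0 := by
  obtain ⟨h, hi⟩ := hp
  intro h0
  exact hi.ne_zero (Subtype.ext h0)

lemma IsUniformizer.exists_valuation_eq [TopologicalSpace K] [IsNonarchimedeanLocalField K]
    {p : K} (hp : IsUniformizer p) {x : K} (hx : x ≠ 0) :
    ∃ k : ℤ, valuation K x = valuation K p ^ k := by
  have key : ∀ y : K, y ≠ 0 → valuation K y ≤ 1 → ∃ k : ℕ, valuation K y = valuation K p ^ k := by
    intro y hy0 hy
    obtain ⟨h, hi⟩ := hp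
    obtain ⟨k, u, hu⟩ := IsDiscreteValuationRing.eq_unit_mul_pow_irreducible
      (x := (⟨y, hy⟩ : 𝒪[K])) (fun h => hy0 (congrArg Subtype.val h)) hi
    refine ⟨k, ?_⟩
    have hu' : y = (u : 𝒪[K]) * p ^ k := congrArg Subtype.val hu
    have h1 : valuation K ((u : 𝒪[K]) : K) = 1 :=
      (Valuation.integer.integers (valuation K)).isUnit_iff_valuation_eq_one.1 u.isUnit
    rw [hu', map_mul, h1, one_mul, map_pow]
  rcases le_total (valuation K x) 1 with h | h
  · obtain ⟨k, hk⟩ := key x hx h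
    exact ⟨k, by simpa using hk⟩
  · obtain ⟨k, hk⟩ := key x⁻¹ (inv_ne_zero hx) (by
      rw [map_inv₀]; exact inv_le_one_of_one_le₀ h)
    refine ⟨-k, ?_⟩
    rw [map_inv₀] at hk
    rw [zpow_neg, zpow_natCast, ← hk, inv_inv]

lemma IsUniformizer.exists_pow_lt [TopologicalSpace K] [IsNonarchimedeanLocalField K]
    {p : K} (hp : IsUniformizer p) {γ : ValueGroupWithZero K} (hγ : γ ≠ 0) :
    ∃ k : ℕ, valuation K p ^ k < γ := by
  obtain ⟨x, rfl⟩ := valuation_surjective γ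
  obtain ⟨k, hk⟩ := hp.exists_valuation_eq ((valuation K).ne_zero_iff.1 hγ)
  refine ⟨(k + 1).toNat, ?_⟩
  rw [hk, ← zpow_natCast]
  have h0 : 0 < valuation K p := zero_lt_iff.2 ((valuation K).ne_zero_iff.2 hp.ne_zero)
  exact zpow_lt_zpow_right_of_lt_one₀ h0 hp.valuation_lt_one (by omega)

/-- A set that is closed contains every point that it approximates to all orders in `p`. -/
lemma IsUniformizer.mem_of_forall_pow [TopologicalSpace K] [IsNonarchimedeanLocalField K]
    {p : K} (hp : IsUniformizer p) {s : Set K} (hs : IsClosed s) {x : K}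
    (h : ∀ k : ℕ, ∃ y ∈ s, valuation K (y - x) ≤ valuation K p ^ k) : x ∈ s := by
  rw [← hs.closure_eq, mem_closure_iff_nhds]
  intro t ht
  obtain ⟨γ, hγ⟩ := IsValuativeTopology.mem_nhds_iff'.1 ht
  obtain ⟨k, hk⟩ := hp.exists_pow_lt γ.ne_zero
  obtain ⟨y, hy, hyx⟩ := h k
  exact ⟨y, hγ (lt_of_le_of_lt hyx hk), hy⟩

lemma sigmaCompactSpace_of_isUniformizer [TopologicalSpace K] [IsNonarchimedeanLocalField K]
    {p : K} (hp : IsUniformizer p) : SigmaCompactSpace K := by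
  refine ⟨⟨fun k => {x | valuation K x ≤ (valuation K p ^ k)⁻¹},
    fun k => IsNonarchimedeanLocalField.isCompact_closedBall K _, ?_⟩⟩
  refine Set.eq_univ_of_forall fun x => Set.mem_iUnion.2 ?_
  have h0 : 0 < valuation K p := zero_lt_iff.2 ((valuation K).ne_zero_iff.2 hp.ne_zero)
  by_cases hx : x = 0
  · exact ⟨0, by simp [hx]⟩
  · obtain ⟨k, hk⟩ := hp.exists_pow_lt
      (γ := (valuation K x)⁻¹) (inv_ne_zero ((valuation K).ne_zero_iff.2 hx))
    refine ⟨k, ?_⟩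
    have hx0 : 0 < valuation K x := zero_lt_iff.2 ((valuation K).ne_zero_iff.2 hx)
    exact (le_inv_comm₀ hx0 (pow_pos h0 k)).2 hk.le

lemma t2Space_of_isNonarchimedeanLocalField (K : Type*) [Field K] [ValuativeRel K]
    [TopologicalSpace K] [IsNonarchimedeanLocalField K] : T2Space K := by
  let := IsTopologicalAddGroup.rightUniformSpace K
  have := isUniformAddGroup_of_addCommGroup (G := K)
  infer_instance

lemma isOpen_valuation_le_one [TopologicalSpace K] [IsNonarchimedeanLocalField K] :
    IsOpen {x : K | valuation K x ≤ 1} := by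
  rw [isOpen_iff_mem_nhds]
  intro x hx
  refine IsValuativeTopology.mem_nhds_iff'.2 ⟨1, fun z hz => ?_⟩
  have := (valuation K).map_add (z - x) x
  rw [sub_add_cancel] at this
  exact this.trans (max_le (le_of_lt hz) hx)

end Uniformizer

/-! ### Automatic continuity of automorphisms of $E$ over $F$. -/

section Involution

variable {F E : Type*} [Field F] [ValuativeRel F] [TopologicalSpace F]
  [IsNonarchimedeanLocalField F] [Field E] [ValuativeRel E] [TopologicalSpace E]
  [IsNonarchimedeanLocalField E] [Algebra F E] [ValuativeExtension F E]

lemma continuous_algebraMap_of_isUniformizer {p : F} (hp : IsUniformizer p)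
    (hpE : IsUniformizer (algebraMap F E p)) : Continuous (algebraMap F E) := by
  refine continuous_of_continuousAt_zero (algebraMap F E) ?_
  rw [ContinuousAt, map_zero, (IsValuativeTopology.hasBasis_nhds_zero' F).tendsto_iff
    (IsValuativeTopology.hasBasis_nhds_zero' E)]
  intro γ hγ
  obtain ⟨k, hk⟩ := hpE.exists_pow_lt hγ
  refine ⟨valuation F p ^ k, pow_ne_zero _ ((valuation F).ne_zero_iff.2 hp.ne_zero), fun x hx => ?_⟩
  refine lt_trans ?_ hk
  rw [Set.mem_ofPred_eq, ← map_pow] at hx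
  rw [← map_pow, ← map_pow]
  rw [← not_le, ← Valuation.Compatible.vle_iff_le] at hx ⊢
  rwa [ValuativeExtension.vle_iff_vle]

/-- The automorphism is given only algebraically. The coordinate map $F^2\to E$ is a continuous
surjective homomorphism from a σ-compact group, hence open, hence a quotient map; in coordinates `σ`
is visibly continuous. -/
lemma continuous_algEquiv {p : F} (hp : IsUniformizer p)
    (hpE : IsUniformizer (algebraMap F E p)) (hdeg : Module.finrank F E = 2)
    (σ : E ≃ₐ[F] E) : Continuous σ := by
  have hc := continuous_algebraMap_of_isUniformizer (E := E) hp hpE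
  have := Module.finite_of_finrank_pos (R := F) (M := E) (by omega)
  let b := Module.finBasisOfFinrankEq F E hdeg
  have := sigmaCompactSpace_of_isUniformizer hp
  have := t2Space_of_isNonarchimedeanLocalField E
  let φ : (Fin 2 → F) →+ E := b.equivFun.symm.toLinearMap.toAddMonoidHom
  have hφ : ∀ c, φ c = ∑ i, algebraMap F E (c i) * b i := fun c => by
    simp [φ, Module.Basis.equivFun_symm_apply, Algebra.smul_def]
  have hφc : Continuous φ := by
    rw [show (φ : (Fin 2 → F) → E) = fun c => ∑ i, algebraMap F E (c i) * b i from funext hφ]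
    fun_prop
  have hφo : IsOpenMap φ :=
    φ.isOpenMap_of_sigmaCompact b.equivFun.symm.surjective hφc
  have hq : Topology.IsQuotientMap φ :=
    hφo.isQuotientMap hφc b.equivFun.symm.surjective
  rw [hq.continuous_iff]
  have : (σ ∘ φ) = fun c => ∑ i, algebraMap F E (c i) * σ (b i) := by
    funext c
    simp [hφ]
  rw [this]
  fun_prop

end Involution

/-! ### Bicontinuous automorphisms preserve the valuation. -/

section Preserve

variable {E : Type*} [Field E] [ValuativeRel E] [TopologicalSpace E] [IsNonarchimedeanLocalField E]

/-- Describes the open unit ball by the topology alone, so that bicontinuous automorphisms preserve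
it. -/
lemma tendsto_pow_iff_valuation_lt_one {p : E} (hp : IsUniformizer p) (x : E) :
    Filter.Tendsto (fun k : ℕ => x ^ k) Filter.atTop (nhds 0) ↔ valuation E x < 1 := by
  rw [(IsValuativeTopology.hasBasis_nhds_zero' E).tendsto_right_iff]
  constructor
  · intro h
    obtain ⟨k, hk⟩ := (h 1 one_ne_zero).exists
    by_contra hx
    rw [not_lt] at hx
    rw [Set.mem_ofPred_eq, map_pow] at hk
    exact absurd (one_le_pow_of_one_le' hx k) (not_le.2 hk)
  · intro hx γ hγ
    by_cases hx0 : x = 0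
    · filter_upwards [Filter.eventually_ge_atTop 1] with k hk
      simp [hx0, show k ≠ 0 by omega, zero_lt_iff, hγ]
    obtain ⟨j, hj⟩ := hp.exists_valuation_eq hx0
    have h0 : 0 < valuation E p := zero_lt_iff.2 ((valuation E).ne_zero_iff.2 hp.ne_zero)
    have hjpos : 0 < j := by
      by_contra hj'
      rw [hj] at hx
      exact absurd (one_le_zpow_of_nonpos₀ h0 hp.valuation_lt_one.le (by omega)) (not_le.2 hx)
    obtain ⟨k, hk⟩ := hp.exists_pow_lt hγ
    filter_upwards [Filter.eventually_ge_atTop k] with i hi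
    rw [map_pow]
    refine lt_of_le_of_lt ?_ hk
    have h1 : valuation E x ≤ valuation E p := by
      rw [hj]
      simpa using zpow_le_zpow_right_of_le_one₀ h0 hp.valuation_lt_one.le (show 1 ≤ j by omega)
    exact (pow_le_pow_left' h1 i).trans (pow_le_pow_right_of_le_one' hp.valuation_lt_one.le hi)

/-- Preserving the open unit ball forces units to go to units (apply it to $u$ and $u^{-1}$). Any
non-zero element is a unit times a power of the fixed element `p`. -/
lemma valuation_ringEquiv {p : E} (hp : IsUniformizer p) (σ : E ≃+* E) (hσp : σ p = p)
    (hσ : Continuous σ) (hσ' : Continuous σ.symm) (x : E) :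
    valuation E (σ x) = valuation E x := by
  have key : ∀ y, valuation E (σ y) < 1 ↔ valuation E y < 1 := by
    intro y
    rw [← tendsto_pow_iff_valuation_lt_one hp, ← tendsto_pow_iff_valuation_lt_one hp]
    constructor
    · intro h
      have := (hσ'.tendsto 0).comp h
      simpa [Function.comp_def] using this
    · intro h
      have := (hσ.tendsto 0).comp h
      simpa [Function.comp_def] using this
  by_cases hx : x = 0
  · simp [hx]
  obtain ⟨k, hk⟩ := hp.exists_valuation_eq hx
  have hp0 := hp.ne_zero
  have hpv : valuation E p ^ k ≠ 0 := zpow_ne_zero _ ((valuation E).ne_zero_iff.2 hp0)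
  set u := x * (p ^ k)⁻¹ with hu
  have hxu : x = u * p ^ k := by rw [hu, inv_mul_cancel_right₀ (zpow_ne_zero _ hp0)]
  have hvu : valuation E u = 1 := by
    rw [hu, map_mul, map_inv₀, map_zpow₀, hk, mul_inv_cancel₀ hpv]
  have hu0 : u ≠ 0 := by
    rintro h; rw [h, map_zero] at hvu; exact zero_ne_one hvu
  have hσu : valuation E (σ u) = 1 := by
    refine le_antisymm ?_ (not_lt.1 fun h => by rw [key, hvu] at h; exact lt_irrefl _ h)
    have h1 : ¬ valuation E (σ u⁻¹) < 1 := by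
      rw [key, map_inv₀, hvu, inv_one]; exact lt_irrefl _
    rw [map_inv₀, map_inv₀, not_lt] at h1
    have h0 : 0 < valuation E (σ u) :=
      zero_lt_iff.2 ((valuation E).ne_zero_iff.2 (by simpa using hu0))
    exact (one_le_inv₀ h0).1 h1
  clear_value u
  rw [hxu, map_mul, map_mul, map_mul, hσu, hvu, map_zpow₀, hσp]

end Preserve

/-! ### Norms and traces for an unramified involution. -/

/-- For an involution of a finite field, every fixed element is a norm. -/
lemma exists_mul_map_eq_of_finite {k : Type*} [Field k] [Finite k] (σ : k →+* k)
    (hσ : ∀ x, σ (σ x) = x) (hne : ∃ x, σ x ≠ x) {u : k} (hu : σ u = u) :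
    ∃ x, x * σ x = u := by
  by_cases hu0 : u = 0
  · exact ⟨0, by simp [hu0]⟩
  let s : kˣ →* kˣ := Units.map σ
  let N : kˣ →* kˣ := MonoidHom.id _ * s
  let T : kˣ →* kˣ := MonoidHom.id _ / s
  have hss : ∀ x : kˣ, s (s x) = x := fun x => Units.ext (hσ x)
  have hNT : N.range ≤ T.ker := by
    rintro _ ⟨x, rfl⟩
    rw [MonoidHom.mem_ker]
    simp [T, N, hss, mul_comm]
  -- Hilbert 90: if $x\,\sigma(x)=1$, then $w=y+x\,\sigma(y)$ satisfies $x\,\sigma(w)=w$. Some $y$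
  -- gives $w\neq0$, since otherwise $y=1$ yields $x=-1$ and then $\sigma$ is the identity.
  have hTN : N.ker ≤ T.range := by
    intro x hx
    have hx1 : (x : k) * σ x = 1 := congrArg Units.val (MonoidHom.mem_ker.1 hx)
    obtain ⟨y, hy⟩ : ∃ y : k, y + x * σ y ≠ 0 := by
      by_contra! hcon
      obtain ⟨z, hz⟩ := hne
      have h1 : (x : k) = -1 := by
        have := hcon 1
        rw [map_one, mul_one] at this
        linear_combination this
      apply hz
      have := hcon z
      rw [h1] at this
      linear_combination -this
    refine ⟨Units.mk0 _ hy, ?_⟩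
    rw [show T (Units.mk0 _ hy) = Units.mk0 _ hy / s (Units.mk0 _ hy) from rfl, div_eq_iff_eq_mul]
    ext
    simp only [Units.val_mk0, Units.val_mul, s, Units.coe_map, MonoidHom.coe_coe, map_add, map_mul,
      hσ]
    linear_combination (-y) * hx1
  -- Counting kernels against images turns $\ker N\le\operatorname{im}T$ into $|\ker
  -- T|\le|\operatorname{im}N|$, so the norms fill the group $\ker T$ of fixed units.
  have h1 : Nat.card N.ker * Nat.card N.range = Nat.card kˣ := by
    rw [← Nat.card_congr (QuotientGroup.quotientKerEquivRange N).toEquiv, mul_comm]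
    exact (Subgroup.card_eq_card_quotient_mul_card_subgroup _).symm
  have h2 : Nat.card T.ker * Nat.card T.range = Nat.card kˣ := by
    rw [← Nat.card_congr (QuotientGroup.quotientKerEquivRange T).toEquiv, mul_comm]
    exact (Subgroup.card_eq_card_quotient_mul_card_subgroup _).symm
  have h3 : Nat.card N.ker ≤ Nat.card T.range := Subgroup.card_le_of_le hTN
  have h4 : Nat.card T.ker ≤ Nat.card N.range := by
    have hpos : 0 < Nat.card N.ker := Nat.card_pos
    by_contra! hlt
    have : Nat.card N.ker * Nat.card N.range < Nat.card T.ker * Nat.card T.range := by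
      calc _ < Nat.card N.ker * Nat.card T.ker := Nat.mul_lt_mul_of_pos_left hlt hpos
        _ ≤ Nat.card T.range * Nat.card T.ker := Nat.mul_le_mul_right _ h3
        _ = _ := mul_comm _ _
    omega
  have h5 : N.range = T.ker := Subgroup.eq_of_le_of_card_ge hNT h4
  have hmem : Units.mk0 u hu0 ∈ N.range := by
    rw [h5, MonoidHom.mem_ker]
    rw [show T (Units.mk0 _ hu0) = Units.mk0 _ hu0 / s (Units.mk0 _ hu0) from rfl,
      div_eq_iff_eq_mul, one_mul]
    ext
    simp [s, hu]
  obtain ⟨x, hx⟩ := hmem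
  exact ⟨x, congrArg Units.val hx⟩

/-- A nontrivial continuous involution of a local field that preserves the valuation and fixes the
uniformizer `p`. -/
structure IsUnramifiedInvolution {E : Type*} [Field E] [ValuativeRel E] [TopologicalSpace E]
    (p : E) (σ : E ≃+* E) : Prop where
  isUniformizer : IsUniformizer p
  map_uniformizer : σ p = p
  involutive : ∀ x, σ (σ x) = x
  exists_ne : ∃ x, σ x ≠ x
  continuous : Continuous σ
  valuation_map : ∀ x, valuation E (σ x) = valuation E x

section

variable {E : Type*} [Field E] [ValuativeRel E] {p : E}

lemma valuation_add_le_one {x y : E} (hx : valuation E x ≤ 1) (hy : valuation E y ≤ 1) :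
    valuation E (x + y) ≤ 1 := (valuation E).map_add_le hx hy

lemma valuation_sub_le_one {x y : E} (hx : valuation E x ≤ 1) (hy : valuation E y ≤ 1) :
    valuation E (x - y) ≤ 1 := (valuation E).map_sub_le hx hy

lemma valuation_mul_le_one {x y : E} (hx : valuation E x ≤ 1) (hy : valuation E y ≤ 1) :
    valuation E (x * y) ≤ 1 := by
  rw [map_mul]; exact mul_le_one' hx hy

lemma IsUniformizer.valuation_pos (hp : IsUniformizer p) : 0 < valuation E p :=
  zero_lt_iff.2 ((valuation E).ne_zero_iff.2 hp.ne_zero)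

lemma IsUniformizer.exists_eq_pow_mul (hp : IsUniformizer p) {x : E} {k : ℕ}
    (hx : valuation E x ≤ valuation E p ^ k) : ∃ c, valuation E c ≤ 1 ∧ x = p ^ k * c := by
  have h0 := pow_pos hp.valuation_pos k
  refine ⟨(p ^ k)⁻¹ * x, ?_, (mul_inv_cancel_left₀ (pow_ne_zero _ hp.ne_zero) x).symm⟩
  rw [map_mul, map_inv₀, map_pow]
  exact (inv_mul_le_one₀ h0).2 hx

end

section

variable {E : Type*} [Field E] [ValuativeRel E] [TopologicalSpace E] [IsNonarchimedeanLocalField E]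
  {p : E} {σ : E ≃+* E}

lemma IsUniformizer.le_of_lt_one (hp : IsUniformizer p) {x : E} (hx : valuation E x < 1) :
    valuation E x ≤ valuation E p := by
  by_cases hx0 : x = 0
  · simp [hx0]
  obtain ⟨j, hj⟩ := hp.exists_valuation_eq hx0
  have hjpos : 0 < j := by
    by_contra hj'
    rw [hj] at hx
    exact absurd (one_le_zpow_of_nonpos₀ hp.valuation_pos hp.valuation_lt_one.le (by omega))
      (not_le.2 hx)
  rw [hj]
  simpa using zpow_le_zpow_right_of_le_one₀ hp.valuation_pos hp.valuation_lt_one.le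
    (show 1 ≤ j by omega)

lemma valuation_residue_lt {x y : 𝒪[E]}
    (h : IsLocalRing.residue 𝒪[E] x = IsLocalRing.residue 𝒪[E] y) :
    valuation E ((x : E) - y) < 1 := by
  rw [← sub_eq_zero, ← map_sub, IsLocalRing.residue_eq_zero_iff] at h
  refine lt_of_le_of_ne (valuation_sub_le_one x.2 y.2) fun h1 => ?_
  exact (IsLocalRing.mem_maximalIdeal _).1 h
    ((Valuation.integer.integers (valuation E)).isUnit_iff_valuation_eq_one.2 h1)

lemma residue_eq_of_valuation_lt {x y : 𝒪[E]} (h : valuation E ((x : E) - y) < 1) :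
    IsLocalRing.residue 𝒪[E] x = IsLocalRing.residue 𝒪[E] y := by
  rw [← sub_eq_zero, ← map_sub, IsLocalRing.residue_eq_zero_iff]
  refine (IsLocalRing.mem_maximalIdeal _).2 fun h1 => ?_
  exact h.ne ((Valuation.integer.integers (valuation E)).isUnit_iff_valuation_eq_one.1 h1)

/-- Frobenius is surjective on a finite residue field of characteristic two. -/
lemma exists_sq_approx (h2 : valuation E (2 : E) < 1) {b : E} (hb : valuation E b ≤ 1) :
    ∃ a, valuation E a ≤ 1 ∧ valuation E (a ^ 2 - b) < 1 := by
  have h20 : (2 : 𝓀[E]) = 0 := by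
    have := residue_eq_of_valuation_lt (x := (2 : 𝒪[E])) (y := 0) (by
      rw [ZeroMemClass.coe_zero, sub_zero]
      exact h2)
    rwa [map_ofNat, map_zero] at this
  have : CharP 𝓀[E] 2 := CharTwo.of_one_ne_zero_of_two_eq_zero one_ne_zero h20
  obtain ⟨r, hr⟩ := FiniteField.isSquare_of_char_two (ringChar.eq 𝓀[E] 2)
    (IsLocalRing.residue 𝒪[E] ⟨b, hb⟩)
  obtain ⟨a, rfl⟩ := IsLocalRing.residue_surjective r
  refine ⟨a, a.2, ?_⟩
  exact valuation_residue_lt (x := a ^ 2) (y := ⟨b, hb⟩) (by rw [hr, map_pow, sq])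

namespace IsUnramifiedInvolution

variable (h : IsUnramifiedInvolution p σ)
include h

/-- `hcon` is the assumption, to be refuted, that `σ` acts trivially on the residue field. If 2 is a
unit, the average of `b` and `σ b` is the approximation; otherwise $b\equiv a^2\equiv a\,\sigma(a)$,
which is fixed. -/
lemma exists_fixed_approx (hcon : ∀ a, valuation E a ≤ 1 → valuation E (a - σ a) < 1)
    {b : E} (hb : valuation E b ≤ 1) :
    ∃ y, σ y = y ∧ valuation E (y - b) ≤ valuation E p := by
  have hv2 : valuation E (2 : E) ≤ 1 := by
    rw [← one_add_one_eq_two]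
    exact valuation_add_le_one (by simp) (by simp)
  rcases hv2.lt_or_eq with h2 | h2
  · obtain ⟨a, ha, hab⟩ := exists_sq_approx h2 hb
    refine ⟨a * σ a, by rw [map_mul, h.involutive, mul_comm], h.isUniformizer.le_of_lt_one ?_⟩
    have : a * σ a - b = (a ^ 2 - b) - a * (a - σ a) := by ring
    rw [this]
    refine (valuation E).map_sub_lt hab ?_
    rw [map_mul]
    exact lt_of_le_of_lt (mul_le_of_le_one_left' ha) (hcon a ha)
  · have h20 : (2 : E) ≠ 0 := by
      intro h0; rw [h0, map_zero] at h2; exact zero_ne_one h2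
    refine ⟨(b + σ b) / 2, ?_, h.isUniformizer.le_of_lt_one ?_⟩
    · rw [map_div₀, map_add, h.involutive, map_ofNat, add_comm]
    · have : (b + σ b) / 2 - b = -((b - σ b) / 2) := by field_simp; ring
      rw [this, Valuation.map_neg, map_div₀, h2, div_one]
      exact hcon b hb

/-- The involution acts nontrivially on the residue field. -/
lemma exists_valuation_sub_eq_one : ∃ a, valuation E a ≤ 1 ∧ valuation E (a - σ a) = 1 := by
  by_contra! hne
  have hcon : ∀ a, valuation E a ≤ 1 → valuation E (a - σ a) < 1 := fun a ha =>
    lt_of_le_of_ne (valuation_sub_le_one ha (by rwa [h.valuation_map])) (hne a ha)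
  have hp := h.isUniformizer
  have := t2Space_of_isNonarchimedeanLocalField E
  have hcl : IsClosed {y | σ y = y} := isClosed_eq h.continuous continuous_id
  -- Since `σ` fixes `p`, approximation modulo `p` can be iterated on the error; fixed points are
  -- then dense in the integers, and they form a closed set.
  have hfix : ∀ b, valuation E b ≤ 1 → σ b = b := by
    intro b hb
    refine hp.mem_of_forall_pow hcl fun k => ?_
    induction k with
    | zero => exact ⟨0, map_zero _, by simpa using hb⟩
    | succ k ih =>
      obtain ⟨y, hy, hyb⟩ := ih
      obtain ⟨c, hc, hyc⟩ := hp.exists_eq_pow_mul hyb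
      obtain ⟨z, hz, hzc⟩ := h.exists_fixed_approx hcon hc
      refine ⟨y - p ^ k * z, ?_, ?_⟩
      · rw [Set.mem_ofPred_eq, map_sub, map_mul, map_pow, h.map_uniformizer, hz, hy]
      · rw [show y - p ^ k * z - b = -(p ^ k * (z - c)) by linear_combination hyc,
          Valuation.map_neg, map_mul, map_pow, pow_succ]
        exact mul_le_mul_right hzc _
  obtain ⟨x, hx⟩ := h.exists_ne
  apply hx
  by_cases hx1 : valuation E x ≤ 1
  · exact hfix x hx1
  · have := hfix x⁻¹ (by rw [map_inv₀]; exact inv_le_one_of_one_le₀ (not_le.1 hx1).le)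
    rwa [map_inv₀, inv_inj] at this

/-- The trace takes a unit value on the integers. -/
lemma exists_valuation_trace_eq_one : ∃ b, valuation E b ≤ 1 ∧ valuation E (b + σ b) = 1 := by
  have hv2 : valuation E (2 : E) ≤ 1 := by
    rw [← one_add_one_eq_two]
    exact valuation_add_le_one (by simp) (by simp)
  rcases hv2.lt_or_eq with h2 | h2
  · obtain ⟨a, ha, ha1⟩ := h.exists_valuation_sub_eq_one
    refine ⟨a, ha, ?_⟩
    -- When 2 is not a unit, trace and difference agree modulo the maximal ideal.
    rw [show a + σ a = (a - σ a) + 2 * σ a by ring]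
    rw [Valuation.map_add_eq_of_lt_left, ha1]
    rw [ha1, map_mul, h.valuation_map]
    exact mul_lt_one_of_lt_of_le h2 ha
  · exact ⟨1, by simp, by rw [map_one, one_add_one_eq_two, h2]⟩

/-- The involution induced on the residue field is non-trivial, so the finite field case applies. -/
lemma exists_norm_approx {u : E} (hu : σ u = u) (hvu : valuation E u ≤ 1) :
    ∃ y, valuation E y ≤ 1 ∧ valuation E (y * σ y - u) < 1 := by
  let s : 𝒪[E] →+* 𝒪[E] := (σ : E →+* E).restrict 𝒪[E] 𝒪[E] fun x hx => by
    change valuation E (σ x) ≤ 1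
    rw [h.valuation_map]; exact hx
  have : IsLocalHom s := ⟨fun x hx => by
    rw [(Valuation.integer.integers (valuation E)).isUnit_iff_valuation_eq_one] at hx ⊢
    have hx' : valuation E (σ x) = 1 := hx
    rwa [h.valuation_map] at hx'⟩
  let sb := IsLocalRing.ResidueField.map s
  have hsb : ∀ x, sb (IsLocalRing.residue _ x) = IsLocalRing.residue _ (s x) := fun x => rfl
  obtain ⟨r, hr⟩ := exists_mul_map_eq_of_finite sb (fun r => by
      obtain ⟨x, rfl⟩ := IsLocalRing.residue_surjective r
      rw [hsb, hsb]
      congr 1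
      exact Subtype.ext (h.involutive x)) (by
      obtain ⟨a, ha, ha1⟩ := h.exists_valuation_sub_eq_one
      refine ⟨IsLocalRing.residue _ ⟨a, ha⟩, fun heq => ?_⟩
      exact (valuation_residue_lt (heq.symm.trans (hsb _))).ne ha1)
    (u := IsLocalRing.residue _ ⟨u, hvu⟩) (by
      rw [hsb]
      congr 1
      exact Subtype.ext hu)
  obtain ⟨y, rfl⟩ := IsLocalRing.residue_surjective r
  rw [hsb, ← map_mul] at hr
  exact ⟨y, y.2, valuation_residue_lt hr⟩

/-- Every fixed unit is a norm. -/
lemma exists_norm_eq {u : E} (hu : σ u = u) (hvu : valuation E u = 1) :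
    ∃ y, valuation E y ≤ 1 ∧ y * σ y = u := by
  have hp := h.isUniformizer
  have := t2Space_of_isNonarchimedeanLocalField E
  have hcont : Continuous fun y => y * σ y := continuous_id.mul h.continuous
  -- Compactness makes the set of norms closed, so approximate solutions to every order suffice.
  have hcl : IsClosed ((fun y => y * σ y) '' {y | valuation E y ≤ 1}) :=
    ((IsNonarchimedeanLocalField.isCompact_closedBall E 1).image hcont).isClosed
  suffices u ∈ (fun y => y * σ y) '' {y | valuation E y ≤ 1} from this
  obtain ⟨b, hb, hb1⟩ := h.exists_valuation_trace_eq_one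
  have hu0 : u ≠ 0 := by
    rintro rfl; rw [map_zero] at hvu; exact zero_ne_one hvu
  have key : ∀ k : ℕ, ∃ y, valuation E y ≤ 1 ∧
      valuation E (y * σ y - u) ≤ valuation E p ^ (k + 1) := by
    intro k
    induction k with
    | zero =>
      obtain ⟨y, hy, hyu⟩ := h.exists_norm_approx hu hvu.le
      exact ⟨y, hy, by simpa using hp.le_of_lt_one hyu⟩
    | succ k ih =>
      obtain ⟨y, hy, hyu⟩ := ih
      obtain ⟨c, hc, hyc⟩ := hp.exists_eq_pow_mul hyu
      set N := y * σ y with hN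
      set t := b + σ b with ht
      have hσN : σ N = N := by rw [hN, map_mul, h.involutive, mul_comm]
      have hσt : σ t = t := by rw [ht, map_add, h.involutive, add_comm]
      have hpk : p ^ (k + 1) ≠ 0 := pow_ne_zero _ hp.ne_zero
      have hvp : valuation E p ^ (k + 1) < 1 :=
        pow_lt_one' hp.valuation_lt_one (Nat.succ_ne_zero k)
      have hvN : valuation E N = 1 := by
        rw [← hvu]
        refine Valuation.map_eq_of_sub_lt _ ?_
        rw [hvu]
        exact lt_of_le_of_lt hyu hvp
      have hN0 : N ≠ 0 := by rintro h0; rw [h0, map_zero] at hvN; exact zero_ne_one hvN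
      have ht0 : t ≠ 0 := by rintro h0; rw [h0, map_zero] at hb1; exact zero_ne_one hb1
      have hσc : σ c = c := by
        have : c = (N - u) / p ^ (k + 1) := by rw [hyc]; field_simp
        rw [this, map_div₀, map_sub, hσN, hu, map_pow, h.map_uniformizer]
      -- Chosen so that $N\,(z+\sigma z)=-c$. Multiplying `y` by $1+p^{k+1}z$ then cancels the error
      -- $p^{k+1}c$ and leaves $p^{2k+2}N\,z\,\sigma(z)$.
      set z := -(c * b) / (t * N) with hz
      have hσz : σ z = -(c * σ b) / (t * N) := by
        rw [hz, map_div₀, map_neg, map_mul, map_mul, hσc, hσt, hσN]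
      have hvz : valuation E z ≤ 1 := by
        rw [hz, map_div₀, Valuation.map_neg, map_mul (valuation E) t, hb1, hvN, one_mul, div_one]
        exact valuation_mul_le_one hc hb
      have htr : N * (z + σ z) = -c := by
        rw [hσz, hz]
        field_simp
        rw [ht]; ring
      refine ⟨y * (1 + p ^ (k + 1) * z), ?_, ?_⟩
      · refine valuation_mul_le_one hy (valuation_add_le_one (by simp) ?_)
        exact valuation_mul_le_one (by rw [map_pow]; exact hvp.le) hvz
      · have : y * (1 + p ^ (k + 1) * z) * σ (y * (1 + p ^ (k + 1) * z)) - u =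
            p ^ (k + 1 + 1) * (p ^ k * (N * (z * σ z))) := by
          rw [map_mul, map_add, map_one, map_mul, map_pow, h.map_uniformizer]
          rw [sub_eq_iff_eq_add] at hyc
          linear_combination (-1 - p ^ (k + 1) * (z + σ z) - p ^ (k + 1) * p ^ (k + 1) * z * σ z) *
            hN + p ^ (k + 1) * htr + hyc
        rw [this, map_mul, map_pow]
        refine mul_le_of_le_one_right' ?_
        refine valuation_mul_le_one ?_ (valuation_mul_le_one hvN.le
          (valuation_mul_le_one hvz (by rwa [h.valuation_map])))
        rw [map_pow]
        exact pow_le_one' hp.valuation_lt_one.le _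
  refine hp.mem_of_forall_pow hcl fun k => ?_
  obtain ⟨y, hy, hyu⟩ := key k
  exact ⟨_, ⟨y, hy, rfl⟩, hyu.trans (pow_le_pow_right_of_le_one' hp.valuation_lt_one.le k.le_succ)⟩

end IsUnramifiedInvolution

end

open Matrix

/-! ### Integral matrices of determinant one. -/

section Integral

variable {E : Type*} [Field E] [ValuativeRel E] {ι κ η : Type*}

/-- All entries of the matrix are integers of the valued field. -/
def IsIntegralMatrix (g : Matrix ι κ E) : Prop := ∀ i j, valuation E (g i j) ≤ 1

lemma IsIntegralMatrix.mul [Fintype κ] {g : Matrix ι κ E} {h : Matrix κ η E}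
    (hg : IsIntegralMatrix g) (hh : IsIntegralMatrix h) : IsIntegralMatrix (g * h) := fun i j => by
  rw [mul_apply]
  exact (valuation E).map_sum_le fun k _ => valuation_mul_le_one (hg i k) (hh k j)

lemma IsIntegralMatrix.submatrix {ι' κ' : Type*} {g : Matrix ι κ E} (hg : IsIntegralMatrix g)
    (r : ι' → ι) (c : κ' → κ) : IsIntegralMatrix (g.submatrix r c) := fun _ _ => hg _ _

lemma IsIntegralMatrix.diagonal [DecidableEq ι] {d : ι → E} (hd : ∀ i, valuation E (d i) ≤ 1) :
    IsIntegralMatrix (diagonal d) := fun i j => by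
  by_cases h : i = j
  · subst h; simpa using hd i
  · simp [diagonal_apply_ne _ h]

lemma IsIntegralMatrix.one [DecidableEq ι] : IsIntegralMatrix (1 : Matrix ι ι E) := by
  rw [← diagonal_one]
  exact IsIntegralMatrix.diagonal fun i => by simp

lemma IsIntegralMatrix.transpose {g : Matrix ι κ E} (hg : IsIntegralMatrix g) :
    IsIntegralMatrix gᵀ := fun i j => hg j i

lemma IsIntegralMatrix.det_le_one [DecidableEq ι] [Fintype ι] {g : Matrix ι ι E}
    (hg : IsIntegralMatrix g) : valuation E g.det ≤ 1 := by
  rw [det_apply]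
  refine (valuation E).map_sum_le fun s _ => ?_
  rw [Units.smul_def, zsmul_eq_mul, map_mul, map_prod]
  refine mul_le_one' ?_ (Finset.prod_le_one' fun i _ => hg _ _)
  rcases Int.units_eq_one_or (Equiv.Perm.sign s) with h | h <;> simp [h]

/-- Integral matrices of determinant one. -/
def IsSpecialIntegral [DecidableEq ι] [Fintype ι] (g : Matrix ι ι E) : Prop :=
  IsIntegralMatrix g ∧ g.det = 1

lemma IsSpecialIntegral.mul [DecidableEq ι] [Fintype ι] {g h : Matrix ι ι E}
    (hg : IsSpecialIntegral g) (hh : IsSpecialIntegral h) : IsSpecialIntegral (g * h) :=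
  ⟨hg.1.mul hh.1, by rw [det_mul, hg.2, hh.2, one_mul]⟩

lemma IsSpecialIntegral.one [DecidableEq ι] [Fintype ι] :
    IsSpecialIntegral (1 : Matrix ι ι E) := ⟨IsIntegralMatrix.one, det_one⟩

lemma IsSpecialIntegral.transpose [DecidableEq ι] [Fintype ι] {g : Matrix ι ι E}
    (hg : IsSpecialIntegral g) : IsSpecialIntegral gᵀ :=
  ⟨hg.1.transpose, by rw [det_transpose, hg.2]⟩

lemma IsSpecialIntegral.transvection [DecidableEq ι] [Fintype ι] {i j : ι} (hij : i ≠ j) {c : E}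
    (hc : valuation E c ≤ 1) : IsSpecialIntegral (transvection i j c) := by
  refine ⟨fun a b => ?_, det_transvection_of_ne i j hij c⟩
  rw [Matrix.transvection, Matrix.add_apply]
  refine valuation_add_le_one (IsIntegralMatrix.one a b) ?_
  rw [single_apply]
  split_ifs
  · exact hc
  · simp

end Integral

/-! ### Diagonalization by pivots of maximal valuation. -/

section Diagonalize

variable {E : Type*} [Field E] [ValuativeRel E] {ι : Type*} [DecidableEq ι] [Fintype ι]

/-- The rows and columns of `x` with index in `S` vanish off the diagonal. -/
def IsDiagOn (S : Finset ι) (x : Matrix ι ι E) : Prop :=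
  ∀ i ∈ S, ∀ j, j ≠ i → x i j = 0 ∧ x j i = 0

/-- The lower unipotent matrix that subtracts multiples of row `i` so as to clear column `i`. -/
def clearCol (x : Matrix ι ι E) (i : ι) : Matrix ι ι E :=
  1 - replicateCol Unit (fun j => if j = i then 0 else x j i / x i i) *
    replicateRow Unit (Pi.single i (1 : E))

lemma clearCol_mul_apply (x y : Matrix ι ι E) (i a b : ι) :
    (clearCol x i * y) a b = y a b - (if a = i then 0 else x a i / x i i) * y i b := by
  have h : (replicateRow Unit (Pi.single i (1 : E)) * y) () b = y i b := by
    simp [mul_apply, Pi.single_apply]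
  rw [clearCol, Matrix.sub_mul, Matrix.sub_apply, Matrix.one_mul, Matrix.mul_assoc, mul_apply]
  simp [h]

lemma isSpecialIntegral_clearCol {x : Matrix ι ι E} {i : ι}
    (hmax : ∀ j, valuation E (x j i) ≤ valuation E (x i i)) :
    IsSpecialIntegral (clearCol x i) := by
  constructor
  · intro a b
    have := clearCol_mul_apply x 1 i a b
    rw [Matrix.mul_one] at this
    rw [this]
    refine valuation_sub_le_one (IsIntegralMatrix.one a b)
      (valuation_mul_le_one ?_ (IsIntegralMatrix.one i b))
    split_ifs
    · simp
    · rw [map_div₀]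
      exact div_le_one_of_le₀ (hmax a) zero_le
  · rw [clearCol, sub_eq_add_neg, ← Matrix.neg_mul, det_one_add_mul_comm]
    simp only [det_unique, Matrix.add_apply, one_apply_eq, mul_apply, replicateRow_apply,
      Pi.single_apply, Matrix.neg_apply, replicateCol_apply, add_eq_left]
    refine Finset.sum_eq_zero fun j _ => ?_
    by_cases h : j = i <;> simp [h]

lemma isDiagOn_clear {x : Matrix ι ι E} {i : ι} (hx : x i i ≠ 0) {S : Finset ι} (hi : i ∉ S)
    (hS : IsDiagOn S x) :
    IsDiagOn (insert i S) (clearCol x i * x * (clearCol xᵀ i)ᵀ) := by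
  have key : ∀ a b, (clearCol x i * x * (clearCol xᵀ i)ᵀ) a b =
      x a b - (if a = i then 0 else x a i / x i i) * x i b -
      (if b = i then 0 else x i b / x i i) *
        (x a i - (if a = i then 0 else x a i / x i i) * x i i) := by
    intro a b
    have h1 : clearCol x i * x * (clearCol xᵀ i)ᵀ = (clearCol xᵀ i * (clearCol x i * x)ᵀ)ᵀ := by
      rw [transpose_mul, transpose_transpose]
    rw [h1, transpose_apply, clearCol_mul_apply, transpose_apply (clearCol x i * x) i a,
      transpose_apply (clearCol x i * x) b a, clearCol_mul_apply, clearCol_mul_apply]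
    rfl
  intro a ha b hba
  rw [Finset.mem_insert] at ha
  rw [key, key]
  by_cases hai : a = i
  · subst hai
    simp only [if_true, if_neg hba]
    constructor <;> field_simp <;> ring
  · have haS : a ∈ S := ha.resolve_left hai
    have h1 := hS a haS i (Ne.symm hai)
    have h2 := hS a haS b hba
    simp [h1.1, h1.2, h2.1, h2.2]

/-- Diagonalization by a relation `R` that allows creating pivots and clearing with them. -/
lemma exists_isDiagOn_univ (Q : Matrix ι ι E → Prop) (R : Matrix ι ι E → Matrix ι ι E → Prop)
    (hrefl : ∀ x, R x x) (htrans : ∀ x y z, R x y → R y z → R x z)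
    (hpiv : ∀ x (S : Finset ι) j k, Q x → IsDiagOn S x → j ∉ S → k ∉ S → x j k ≠ 0 →
      (∀ a ∉ S, ∀ b ∉ S, valuation E (x a b) ≤ valuation E (x j k)) →
      ∃ y, R x y ∧ Q y ∧ IsDiagOn S y ∧ ∃ i ∉ S, y i i ≠ 0 ∧
        ∀ a ∉ S, ∀ b ∉ S, valuation E (y a b) ≤ valuation E (y i i))
    (hclear : ∀ x i, Q x → x i i ≠ 0 → (∀ a, valuation E (x a i) ≤ valuation E (x i i)) →
      (∀ a, valuation E (x i a) ≤ valuation E (x i i)) →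
      R x (clearCol x i * x * (clearCol xᵀ i)ᵀ) ∧ Q (clearCol x i * x * (clearCol xᵀ i)ᵀ))
    (x : Matrix ι ι E) (hx : Q x) : ∃ y, R x y ∧ Q y ∧ IsDiagOn Finset.univ y := by
  -- Induction on the number of indices not yet cleared. A pivot of maximal valuation outside `S`
  -- makes all the quotients used for clearing integral.
  have main : ∀ (m : ℕ) (S : Finset ι), Sᶜ.card = m → ∀ x, Q x → IsDiagOn S x →
      ∃ y, R x y ∧ Q y ∧ IsDiagOn Finset.univ y := by
    intro m
    induction m with
    | zero =>
      intro S hm x hQ hS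
      rw [Finset.card_eq_zero, Finset.compl_eq_empty_iff] at hm
      exact ⟨x, hrefl x, hQ, hm ▸ hS⟩
    | succ m ih =>
      intro S hm x hQ hS
      by_cases hz : ∀ a ∉ S, ∀ b ∉ S, x a b = 0
      · refine ⟨x, hrefl x, hQ, fun a _ b hba => ?_⟩
        by_cases haS : a ∈ S
        · exact hS a haS b hba
        · by_cases hbS : b ∈ S
          · exact (hS b hbS a (Ne.symm hba)).symm
          · exact ⟨hz a haS b hbS, hz b hbS a haS⟩
      · push Not at hz
        obtain ⟨a₀, ha₀, b₀, hb₀, h0⟩ := hz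
        obtain ⟨⟨j, k⟩, hjk, hmax⟩ := Finset.exists_max_image (Sᶜ ×ˢ Sᶜ)
          (fun q => valuation E (x q.1 q.2)) ⟨(a₀, b₀), by simp [ha₀, hb₀]⟩
        simp only [Finset.mem_product, Finset.mem_compl] at hjk
        have hmax' : ∀ a ∉ S, ∀ b ∉ S, valuation E (x a b) ≤ valuation E (x j k) :=
          fun a ha b hb => hmax (a, b) (by simp [ha, hb])
        have hjk0 : x j k ≠ 0 := by
          intro h
          have := hmax' a₀ ha₀ b₀ hb₀
          rw [h, map_zero, le_zero_iff, (valuation E).zero_iff] at this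
          exact h0 this
        obtain ⟨y, hxy, hQy, hSy, i, hi, hyi, hymax⟩ :=
          hpiv x S j k hQ hS hjk.1 hjk.2 hjk0 hmax'
        have hcol : ∀ a, valuation E (y a i) ≤ valuation E (y i i) ∧
            valuation E (y i a) ≤ valuation E (y i i) := by
          intro a
          by_cases ha : a ∈ S
          · have hia : i ≠ a := fun h => hi (h ▸ ha)
            simp [(hSy a ha i hia).1, (hSy a ha i hia).2]
          · exact ⟨hymax a ha i hi, hymax i hi a ha⟩
        obtain ⟨hyz, hQz⟩ := hclear y i hQy hyi (fun a => (hcol a).1) (fun a => (hcol a).2)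
        have hzS := isDiagOn_clear hyi hi hSy
        obtain ⟨w, hw, hQw, hdw⟩ := ih (insert i S) (by
          have h1 := Finset.card_compl_add_card S
          have h2 := Finset.card_compl_add_card (insert i S)
          rw [Finset.card_insert_of_notMem hi] at h2
          omega) _ hQz hzS
        exact ⟨w, htrans _ _ _ hxy (htrans _ _ _ hyz hw), hQw, hdw⟩
  exact main _ ∅ rfl x hx (fun i hi => absurd hi (Finset.notMem_empty i))

lemma transvection_mul_mul_apply (x : Matrix ι ι E) (j k : ι) (c d : E) (a b : ι) :
    (transvection j k c * x * transvection k j d) a b =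
      x a b + (if a = j then c * x k b else 0) +
        (if b = j then d * (x a k + if a = j then c * x k k else 0) else 0) := by
  have h1 : ∀ a b, (transvection j k c * x) a b = x a b + if a = j then c * x k b else 0 := by
    intro a b
    split_ifs with h
    · subst h; rw [transvection_mul_apply_same]
    · rw [transvection_mul_apply_of_ne _ _ _ _ h, add_zero]
  by_cases hb : b = j
  · subst hb
    rw [mul_transvection_apply_same, h1, h1, if_pos rfl]
  · rw [mul_transvection_apply_of_ne _ _ _ _ hb, h1, if_neg hb, add_zero]

lemma IsDiagOn.transvection {x : Matrix ι ι E} {S : Finset ι} (hS : IsDiagOn S x) {j k : ι}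
    (hj : j ∉ S) (hk : k ∉ S) (c d : E) :
    IsDiagOn S (transvection j k c * x * transvection k j d) := by
  intro a ha b hba
  have haj : a ≠ j := fun h => hj (h ▸ ha)
  have hak : a ≠ k := fun h => hk (h ▸ ha)
  rw [transvection_mul_mul_apply, transvection_mul_mul_apply]
  simp [haj, (hS a ha b hba).1, (hS a ha b hba).2, (hS a ha k hak.symm).1,
    (hS a ha k hak.symm).2]

/-- Ensures that a new diagonal entry reaching the old maximum `M` is still maximal after the
transvections. -/
lemma valuation_transvection_le {x : Matrix ι ι E} {S : Finset ι} {j k : ι}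
    (hk : k ∉ S) {c d : E} (hc : valuation E c ≤ 1) (hd : valuation E d ≤ 1)
    {M : ValueGroupWithZero E} (hM : ∀ a ∉ S, ∀ b ∉ S, valuation E (x a b) ≤ M)
    {a b : ι} (ha : a ∉ S) (hb : b ∉ S) :
    valuation E ((transvection j k c * x * transvection k j d) a b) ≤ M := by
  have hmul : ∀ {c z : E}, valuation E c ≤ 1 → valuation E z ≤ M → valuation E (c * z) ≤ M := by
    intro c z hc hz
    rw [map_mul]
    exact (mul_le_of_le_one_left' hc).trans hz
  have hif : ∀ {q : Prop} [Decidable q] {z : E}, valuation E z ≤ M →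
      valuation E (if q then z else 0) ≤ M := by
    intro q _ z hz
    split_ifs
    · exact hz
    · simp
  rw [transvection_mul_mul_apply]
  exact (valuation E).map_add_le ((valuation E).map_add_le (hM a ha b hb)
    (hif (hmul hc (hM k hk b hb)))) (hif (hmul hd ((valuation E).map_add_le (hM a ha k hk)
    (hif (hmul hc (hM k hk k hk))))))

lemma IsDiagOn.eq_diagonal {x : Matrix ι ι E} (hx : IsDiagOn Finset.univ x) :
    x = diagonal fun i => x i i := by
  ext i j
  by_cases h : i = j
  · subst h; simp
  · rw [diagonal_apply_ne _ h]
    exact (hx i (Finset.mem_univ i) j (Ne.symm h)).1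

/-- Every square matrix is diagonalized by integral matrices of determinant one on both sides. -/
lemma exists_mul_mul_eq_diagonal (x : Matrix ι ι E) :
    ∃ g h : Matrix ι ι E, IsSpecialIntegral g ∧ IsSpecialIntegral h ∧
      ∃ d : ι → E, g * x * h = diagonal d := by
  obtain ⟨y, ⟨g, h, hg, hh, hy⟩, -, hd⟩ := exists_isDiagOn_univ (fun _ => True)
    (fun x y => ∃ g h : Matrix ι ι E, IsSpecialIntegral g ∧ IsSpecialIntegral h ∧ g * x * h = y)
    (fun x => ⟨1, 1, .one, .one, by simp⟩)
    (by
      rintro x y z ⟨g, h, hg, hh, rfl⟩ ⟨g', h', hg', hh', rfl⟩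
      exact ⟨g' * g, h * h', hg'.mul hg, hh.mul hh', by simp only [Matrix.mul_assoc]⟩)
    (by
      intro x S j k _ hS hj hk hjk hmax
      by_cases hjj : valuation E (x j j) = valuation E (x j k)
      · refine ⟨x, ⟨1, 1, .one, .one, by simp⟩, trivial, hS, j, hj, ?_, by rwa [hjj]⟩
        rwa [← (valuation E).ne_zero_iff, hjj, (valuation E).ne_zero_iff]
      have hne : j ≠ k := by rintro rfl; exact hjj rfl
      have hlt : valuation E (x j j) < valuation E (x j k) :=
        lt_of_le_of_ne (hmax j hj j hj) hjj
      -- Only column `k` is added to column `j`: the coefficient 0 makes the left factor trivial.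
      -- The new entry $x_{jj}+x_{jk}$ has the valuation of its strictly larger term.
      have hv : valuation E ((transvection j k (0 : E) * x * transvection k j (1 : E)) j j) =
          valuation E (x j k) := by
        rw [transvection_mul_mul_apply]
        simp only [if_true, zero_mul, add_zero, one_mul]
        exact Valuation.map_add_eq_of_lt_right _ hlt
      refine ⟨transvection j k (0 : E) * x * transvection k j (1 : E),
        ⟨_, _, .transvection hne (by simp), .transvection hne.symm (by simp), rfl⟩, trivial,
        hS.transvection hj hk _ _, j, hj, ?_, fun a ha b hb => ?_⟩
      · rwa [← (valuation E).ne_zero_iff, hv, (valuation E).ne_zero_iff]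
      · rw [hv]
        exact valuation_transvection_le hk (by simp) (by simp) hmax ha hb)
    (by
      intro x i _ hi h1 h2
      exact ⟨⟨_, _, isSpecialIntegral_clearCol h1,
        (isSpecialIntegral_clearCol (x := xᵀ) h2).transpose, rfl⟩, trivial⟩)
    x trivial
  exact ⟨g, h, hg, hh, _, hy.trans hd.eq_diagonal⟩

end Diagonalize

/-! ### Diagonalization of Hermitian matrices by congruence. -/

section Hermitian

variable {E : Type*} [Field E] [ValuativeRel E] [TopologicalSpace E] [IsNonarchimedeanLocalField E]
  {p : E} {σ : E ≃+* E} {ι : Type*} [DecidableEq ι] [Fintype ι]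

/-- The conjugate transpose with respect to `σ`. -/
def conjT (σ : E ≃+* E) (x : Matrix ι ι E) : Matrix ι ι E := (xᵀ).map σ

lemma conjT_mul (x y : Matrix ι ι E) : conjT σ (x * y) = conjT σ y * conjT σ x := by
  rw [conjT, transpose_mul, Matrix.map_mul]
  rfl

lemma conjT_apply (x : Matrix ι ι E) (i j : ι) : conjT σ x i j = σ (x j i) := rfl

lemma conjT_one : conjT σ (1 : Matrix ι ι E) = 1 := by
  rw [conjT, transpose_one]
  exact Matrix.map_one _ (map_zero _) (map_one _)

lemma conjT_diagonal (d : ι → E) : conjT σ (diagonal d) = diagonal fun i => σ (d i) := by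
  rw [conjT, diagonal_transpose]
  exact diagonal_map (map_zero _)

lemma det_conjT (x : Matrix ι ι E) : (conjT σ x).det = σ x.det := by
  rw [conjT, ← det_transpose x]
  exact (RingHom.map_det (σ : E →+* E) _).symm

lemma conjT_transvection (i j : ι) (c : E) :
    conjT σ (transvection i j c) = transvection j i (σ c) := by
  ext a b
  simp only [conjT_apply, Matrix.transvection, Matrix.add_apply, map_add, one_apply, single_apply]
  congr 1
  · by_cases h : a = b <;> simp [h, eq_comm]
  · by_cases h : i = b ∧ j = a
    · simp [h.1, h.2]
    · have h' : ¬ (j = a ∧ i = b) := fun h'' => h h''.symm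
      simp [h, h']

lemma conjT_clearCol {x : Matrix ι ι E} (hx : conjT σ x = x) (i : ι) :
    conjT σ (clearCol x i) = (clearCol xᵀ i)ᵀ := by
  have hx' : ∀ a b, σ (x a b) = x b a := fun a b => congrFun (congrFun hx b) a
  ext a b
  have h1 : ∀ (y : Matrix ι ι E) (a b : ι), clearCol y i a b = (1 : Matrix ι ι E) a b -
      (if a = i then 0 else y a i / y i i) * (1 : Matrix ι ι E) i b := fun y a b => by
    rw [← clearCol_mul_apply, Matrix.mul_one]
  rw [conjT_apply, transpose_apply, h1, h1, map_sub, map_mul]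
  have h2 : ∀ a b : ι, σ ((1 : Matrix ι ι E) a b) = (1 : Matrix ι ι E) a b := fun a b => by
    rw [one_apply]; split_ifs <;> simp
  rw [h2, h2]
  by_cases hb : b = i
  · simp [hb]
  · simp [hb, map_div₀, hx']

namespace IsUnramifiedInvolution

variable (h : IsUnramifiedInvolution p σ)
include h

lemma conjT_conjT (x : Matrix ι ι E) : conjT σ (conjT σ x) = x := by
  ext i j
  exact h.involutive _

/-- Take $c=bp^k/z$ with $|z|=|p|^k$ and `b` of unit trace: the trace of $cz$ is $p^k(b+\sigma b)$.
-/
lemma exists_trace_mul_eq {z : E} :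
    ∃ c, valuation E c ≤ 1 ∧ valuation E (c * z + σ c * σ z) = valuation E z := by
  obtain ⟨b, hb, hb1⟩ := h.exists_valuation_trace_eq_one
  by_cases hz : z = 0
  · exact ⟨0, by simp, by simp [hz]⟩
  obtain ⟨k, hk⟩ := h.isUniformizer.exists_valuation_eq hz
  have hpk : p ^ k ≠ 0 := zpow_ne_zero _ h.isUniformizer.ne_zero
  have hz0 : valuation E z ≠ 0 := (valuation E).ne_zero_iff.2 hz
  refine ⟨b * p ^ k / z, ?_, ?_⟩
  · rw [map_div₀, map_mul, map_zpow₀, ← hk, mul_div_cancel_right₀ _ hz0]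
    exact hb
  · have hσz : σ z ≠ 0 := by simpa using hz
    have : b * p ^ k / z * z + σ (b * p ^ k / z) * σ z = (b + σ b) * p ^ k := by
      rw [map_div₀, map_mul, map_zpow₀, h.map_uniformizer]
      field_simp
    rw [this, map_mul, hb1, one_mul, map_zpow₀, hk]

/-- Hermitian matrices are diagonalized by integral matrices of determinant one. -/
lemma exists_mul_conjT_eq_diagonal {x : Matrix ι ι E} (hx : conjT σ x = x) :
    ∃ g : Matrix ι ι E, IsSpecialIntegral g ∧ ∃ d : ι → E, g * x * conjT σ g = diagonal d := by
  have hQ : ∀ g x : Matrix ι ι E, conjT σ x = x →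
      conjT σ (g * x * conjT σ g) = g * x * conjT σ g := by
    intro g x hx
    rw [conjT_mul, conjT_mul, h.conjT_conjT, hx, Matrix.mul_assoc]
  obtain ⟨y, ⟨g, hg, hy⟩, -, hd⟩ := exists_isDiagOn_univ (fun x => conjT σ x = x)
    (fun x y => ∃ g : Matrix ι ι E, IsSpecialIntegral g ∧ g * x * conjT σ g = y)
    (fun x => ⟨1, .one, by simp [conjT_one]⟩)
    (by
      rintro x y z ⟨g, hg, rfl⟩ ⟨g', hg', rfl⟩
      exact ⟨g' * g, hg'.mul hg, by rw [conjT_mul]; simp only [Matrix.mul_assoc]⟩)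
    (by
      intro x S j k hx hS hj hk hjk hmax
      have hx' : ∀ a b, σ (x a b) = x b a := fun a b => congrFun (congrFun hx b) a
      have triv : ∀ i ∉ S, valuation E (x i i) = valuation E (x j k) →
          ∃ y, (∃ g : Matrix ι ι E, IsSpecialIntegral g ∧ g * x * conjT σ g = y) ∧
            conjT σ y = y ∧ IsDiagOn S y ∧ ∃ i ∉ S, y i i ≠ 0 ∧
            ∀ a ∉ S, ∀ b ∉ S, valuation E (y a b) ≤ valuation E (y i i) := by
        intro i hi hii
        refine ⟨x, ⟨1, .one, by simp [conjT_one]⟩, hx, hS, i, hi, ?_, by rwa [hii]⟩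
        rwa [← (valuation E).ne_zero_iff, hii, (valuation E).ne_zero_iff]
      by_cases hjj : valuation E (x j j) = valuation E (x j k)
      · exact triv j hj hjj
      by_cases hkk : valuation E (x k k) = valuation E (x j k)
      · exact triv k hk hkk
      have hne : j ≠ k := by rintro rfl; exact hjj rfl
      have hltj : valuation E (x j j) < valuation E (x j k) :=
        lt_of_le_of_ne (hmax j hj j hj) hjj
      have hltk : valuation E (x k k) < valuation E (x j k) :=
        lt_of_le_of_ne (hmax k hk k hk) hkk
      -- After adding `c` times row `k` to row `j` and its conjugate for columns, the `j`-th
      -- diagonal entry is $x_{jj}+c\,\sigma(c)\,x_{kk}$ plus the trace of $c\,x_{kj}$. The trace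
      -- has maximal valuation and the other terms are strictly smaller.
      obtain ⟨c, hc, hcz⟩ := h.exists_trace_mul_eq (z := x k j)
      have hσc : valuation E (σ c) ≤ 1 := by rwa [h.valuation_map]
      have hkj : valuation E (x k j) = valuation E (x j k) := by
        rw [← hx' j k, h.valuation_map]
      have hy : transvection j k c * x * transvection k j (σ c) =
          transvection j k c * x * conjT σ (transvection j k c) := by rw [conjT_transvection]
      have hv : valuation E ((transvection j k c * x * transvection k j (σ c)) j j) =
          valuation E (x j k) := by
        rw [transvection_mul_mul_apply]
        simp only [if_true]
        rw [show x j j + c * x k j + σ c * (x j k + c * x k k) =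
          (x j j + σ c * c * x k k) + (c * x k j + σ c * σ (x k j)) by rw [hx']; ring]
        rw [← hkj, ← hcz]
        refine (valuation E).map_add_eq_of_lt_right ?_
        rw [hcz, hkj]
        refine (valuation E).map_add_lt hltj ?_
        rw [map_mul]
        exact lt_of_le_of_lt (mul_le_of_le_one_left' (valuation_mul_le_one hσc hc)) hltk
      refine ⟨transvection j k c * x * transvection k j (σ c),
        ⟨_, .transvection hne hc, hy.symm⟩, by rw [hy]; exact hQ _ _ hx,
        hS.transvection hj hk _ _, j, hj, ?_, fun a ha b hb => ?_⟩
      · rwa [← (valuation E).ne_zero_iff, hv, (valuation E).ne_zero_iff]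
      · rw [hv]
        exact valuation_transvection_le hk hc hσc hmax ha hb)
    (by
      intro x i hx hi h1 h2
      rw [← conjT_clearCol hx]
      exact ⟨⟨_, isSpecialIntegral_clearCol h1, rfl⟩, hQ _ _ hx⟩)
    x hx
  exact ⟨g, hg, _, hy.trans hd.eq_diagonal⟩

end IsUnramifiedInvolution

end Hermitian

/-! ### Dominant normal forms in the group and in the Hermitian space. -/

section NormalForm

lemma zpow_sum₀ {Γ ι : Type*} [CommGroupWithZero Γ] {a : Γ} (ha : a ≠ 0) (s : Finset ι)
    (e : ι → ℤ) : a ^ (∑ i ∈ s, e i) = ∏ i ∈ s, a ^ e i := by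
  induction s using Finset.cons_induction with
  | empty => simp
  | cons i s hi ih => rw [Finset.prod_cons, Finset.sum_cons, zpow_add₀ ha, ih]

variable {E : Type*} [Field E] [ValuativeRel E] [TopologicalSpace E] [IsNonarchimedeanLocalField E]
  {p : E} {σ : E ≃+* E} {n : ℕ}

/-- Permutation matrices conjugate diagonal matrices to diagonal matrices. -/
lemma permMatrix_mul_diagonal_mul {ι : Type*} [Fintype ι] [DecidableEq ι] (s : Equiv.Perm ι)
    (d : ι → E) :
    (1 : Matrix ι ι E).submatrix s id * diagonal d * (1 : Matrix ι ι E).submatrix id s =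
      diagonal (d ∘ s) := by
  ext i j
  simp only [mul_apply, submatrix_apply, id, one_apply, diagonal_apply, Function.comp_apply]
  by_cases hij : i = j
  · subst hij; simp
  · simp [hij]

lemma exists_antitone_comp_perm (e : Fin n → ℤ) : ∃ s : Equiv.Perm (Fin n), Antitone (e ∘ s) := by
  refine ⟨Tuple.sort (fun i => -e i), fun i j hij => ?_⟩
  have := Tuple.monotone_sort (fun i => -e i) hij
  simpa using this

/-- Write a nonvanishing family with product one as units times powers of the uniformizer. -/
lemma exists_unit_mul_zpow (hp : IsUniformizer p) {d : Fin n → E} (hd : ∏ i, d i = 1) :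
    ∃ (e : Fin n → ℤ), ∑ i, e i = 0 ∧ ∀ i, valuation E (d i * p ^ (-e i)) = 1 := by
  have hd0 : ∀ i, d i ≠ 0 := fun i hi => by
    rw [Finset.prod_eq_zero (Finset.mem_univ i) hi] at hd
    exact zero_ne_one hd
  choose e he using fun i => hp.exists_valuation_eq (hd0 i)
  have hp0 : valuation E p ≠ 0 := hp.valuation_pos.ne'
  refine ⟨e, ?_, fun i => ?_⟩
  · have h1 : valuation E p ^ (∑ i, e i) = valuation E p ^ (0 : ℤ) := by
      rw [zpow_sum₀ hp0, zpow_zero, ← map_one (valuation E), ← hd, map_prod]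
      exact Finset.prod_congr rfl fun i _ => (he i).symm
    exact zpow_right_injective₀ hp.valuation_pos hp.valuation_lt_one.ne h1
  · rw [map_mul, map_zpow₀, he, _root_.zpow_neg, mul_inv_cancel₀ (zpow_ne_zero _ hp0)]

lemma prod_zpow_eq_one (hp : p ≠ 0) {e : Fin n → ℤ} (he : ∑ i, e i = 0) :
    ∏ i, p ^ e i = 1 := by
  rw [← zpow_sum₀ hp, he, zpow_zero]

/-- The Cartan decomposition: matrices of determinant one are integrally equivalent to a dominant
diagonal matrix of powers of the uniformizer. -/
theorem exists_cartan (hp : IsUniformizer p) {x : Matrix (Fin n) (Fin n) E} (hx : x.det = 1) :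
    ∃ g h : Matrix (Fin n) (Fin n) E, IsSpecialIntegral g ∧ IsSpecialIntegral h ∧
      ∃ e : Fin n → ℤ, Antitone e ∧ ∑ i, e i = 0 ∧ g * x * h = diagonal fun i => p ^ e i := by
  obtain ⟨g, h, hg, hh, d, hd⟩ := exists_mul_mul_eq_diagonal x
  have hdet : ∏ i, d i = 1 := by
    rw [← det_diagonal, ← hd, det_mul, det_mul, hg.2, hh.2, hx, one_mul, one_mul]
  obtain ⟨e, he0, he⟩ := exists_unit_mul_zpow hp hdet
  obtain ⟨s, hs⟩ := exists_antitone_comp_perm e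
  have hes : ∑ i, (e ∘ s) i = 0 := by rw [← he0]; exact Equiv.sum_comp s e
  have hd0 : ∀ i, d i ≠ 0 := fun i hi => by
    rw [Finset.prod_eq_zero (Finset.mem_univ i) hi] at hdet
    exact zero_ne_one hdet
  have hp0 := hp.ne_zero
  set L := (1 : Matrix (Fin n) (Fin n) E).submatrix s id *
    (diagonal fun i => (d i * p ^ (-e i))⁻¹) * g with hL
  set R := h * (1 : Matrix (Fin n) (Fin n) E).submatrix id s with hR
  have hLint : IsIntegralMatrix L :=
    ((IsIntegralMatrix.one.submatrix _ _).mul (IsIntegralMatrix.diagonal fun i => by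
      rw [map_inv₀, he, inv_one])).mul hg.1
  have hRint : IsIntegralMatrix R := hh.1.mul (IsIntegralMatrix.one.submatrix _ _)
  have hLR : L * x * R = diagonal fun i => p ^ (e ∘ s) i := by
    calc L * x * R = (1 : Matrix (Fin n) (Fin n) E).submatrix s id *
          ((diagonal fun i => (d i * p ^ (-e i))⁻¹) * (g * x * h)) *
          (1 : Matrix (Fin n) (Fin n) E).submatrix id s := by
            rw [hL, hR]; simp only [Matrix.mul_assoc]
      _ = _ := by
        rw [hd, diagonal_mul_diagonal, permMatrix_mul_diagonal_mul]
        congr 1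
        funext i
        have := hd0 (s i)
        simp only [Function.comp_apply, _root_.zpow_neg]
        field_simp
  have hdetLR : L.det * R.det = 1 := by
    have := congrArg Matrix.det hLR
    rwa [det_mul, det_mul, hx, mul_one, det_diagonal, prod_zpow_eq_one hp0 hes] at this
  rcases isEmpty_or_nonempty (Fin n) with hn | ⟨⟨i₀⟩⟩
  · exact ⟨L, R, ⟨hLint, det_isEmpty⟩, ⟨hRint, det_isEmpty⟩, _, hs, hes, hLR⟩
  -- `L` and `R` need not have determinant one, but the product of their determinants is one.
  -- Scaling row `i₀` by `R.det` and column `i₀` by `L.det` corrects both and keeps the diagonal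
  -- matrix.
  · have hupd : ∀ c : E, valuation E c ≤ 1 →
        IsIntegralMatrix (diagonal (Function.update (1 : Fin n → E) i₀ c)) := fun c hc =>
      IsIntegralMatrix.diagonal fun i => by
        by_cases hi : i = i₀
        · subst hi; simpa using hc
        · simp [hi]
    have hudet : ∀ c : E, (diagonal (Function.update (1 : Fin n → E) i₀ c)).det = c := fun c => by
      rw [det_diagonal, Finset.prod_update_of_mem (Finset.mem_univ _)]; simp
    refine ⟨diagonal (Function.update 1 i₀ R.det) * L, R * diagonal (Function.update 1 i₀ L.det),
      ⟨(hupd _ hRint.det_le_one).mul hLint, ?_⟩, ⟨hRint.mul (hupd _ hLint.det_le_one), ?_⟩,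
      _, hs, hes, ?_⟩
    · rw [det_mul, hudet, mul_comm, hdetLR]
    · rw [det_mul, hudet, mul_comm, hdetLR]
    · calc _ = diagonal (Function.update 1 i₀ R.det) * (L * x * R) *
            diagonal (Function.update 1 i₀ L.det) := by simp only [Matrix.mul_assoc]
        _ = _ := by
          rw [hLR, diagonal_mul_diagonal, diagonal_mul_diagonal]
          congr 1
          funext i
          by_cases hi : i = i₀
          · subst hi
            simp only [Function.update_self]
            linear_combination (p ^ (e ∘ s) i) * hdetLR
          · simp [hi]

/-- Hermitian matrices of determinant one are integrally congruent to a dominant diagonal matrix of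
powers of the uniformizer. -/
theorem IsUnramifiedInvolution.exists_normalForm (h : IsUnramifiedInvolution p σ)
    {x : Matrix (Fin n) (Fin n) E} (hx : x.det = 1) (hσx : conjT σ x = x) :
    ∃ g : Matrix (Fin n) (Fin n) E, IsSpecialIntegral g ∧
      ∃ e : Fin n → ℤ, Antitone e ∧ ∑ i, e i = 0 ∧
        g * x * conjT σ g = diagonal fun i => p ^ e i := by
  have hp := h.isUniformizer
  obtain ⟨g, hg, d, hd⟩ := h.exists_mul_conjT_eq_diagonal hσx
  have hdet : ∏ i, d i = 1 := by
    rw [← det_diagonal, ← hd, det_mul, det_mul, det_conjT, hg.2, hx, map_one, one_mul, one_mul]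
  have hσd : ∀ i, σ (d i) = d i := by
    have h1 : conjT σ (diagonal d) = diagonal d := by
      rw [← hd, conjT_mul, conjT_mul, h.conjT_conjT, hσx, Matrix.mul_assoc]
    rw [conjT_diagonal] at h1
    exact fun i => congrFun (diagonal_injective h1) i
  obtain ⟨e, he0, he⟩ := exists_unit_mul_zpow hp hdet
  obtain ⟨s, hs⟩ := exists_antitone_comp_perm e
  have hes : ∑ i, (e ∘ s) i = 0 := by rw [← he0]; exact Equiv.sum_comp s e
  have hd0 : ∀ i, d i ≠ 0 := fun i hi => by
    rw [Finset.prod_eq_zero (Finset.mem_univ i) hi] at hdet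
    exact zero_ne_one hdet
  have hp0 := hp.ne_zero
  -- The unit parts of the diagonal entries are fixed by `σ`, so their inverses are norms and
  -- congruence by `diagonal y` removes them.
  choose y hy hyN using fun i => h.exists_norm_eq (u := (d i * p ^ (-e i))⁻¹)
    (by rw [map_inv₀, map_mul, hσd, map_zpow₀, h.map_uniformizer]) (by rw [map_inv₀, he, inv_one])
  set P := (1 : Matrix (Fin n) (Fin n) E).submatrix s id with hP
  have hPc : conjT σ P = (1 : Matrix (Fin n) (Fin n) E).submatrix id s := by
    ext i j
    rw [conjT_apply, hP, submatrix_apply, submatrix_apply, one_apply, one_apply]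
    by_cases hij : s j = i
    · simp [hij]
    · simp [hij, Ne.symm hij]
  set L := P * diagonal y * g with hL
  have hLint : IsIntegralMatrix L :=
    ((IsIntegralMatrix.one.submatrix _ _).mul (IsIntegralMatrix.diagonal hy)).mul hg.1
  have hLL : L * x * conjT σ L = diagonal fun i => p ^ (e ∘ s) i := by
    calc L * x * conjT σ L = P * (diagonal y * (g * x * conjT σ g) *
          diagonal (fun i => σ (y i))) * (1 : Matrix (Fin n) (Fin n) E).submatrix id s := by
            rw [hL, conjT_mul, conjT_mul, hPc, conjT_diagonal]; simp only [Matrix.mul_assoc]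
      _ = _ := by
        rw [hd, diagonal_mul_diagonal, diagonal_mul_diagonal, permMatrix_mul_diagonal_mul]
        congr 1
        funext i
        have h1 := hd0 (s i)
        simp only [Function.comp_apply]
        rw [mul_right_comm, hyN, _root_.zpow_neg]
        field_simp
  have hdetL : L.det * σ L.det = 1 := by
    have := congrArg Matrix.det hLL
    rwa [det_mul, det_mul, det_conjT, hx, mul_one, det_diagonal, prod_zpow_eq_one hp0 hes] at this
  rcases isEmpty_or_nonempty (Fin n) with hn | ⟨⟨i₀⟩⟩
  · exact ⟨L, ⟨hLint, det_isEmpty⟩, _, hs, hes, hLL⟩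
  -- Since `L.det` has norm one, this rescaling gives determinant one without changing the diagonal
  -- matrix.
  · refine ⟨diagonal (Function.update 1 i₀ (σ L.det)) * L, ⟨IsIntegralMatrix.mul
      (IsIntegralMatrix.diagonal fun i => ?_) hLint, ?_⟩, _, hs, hes, ?_⟩
    · by_cases hi : i = i₀
      · subst hi
        simpa [h.valuation_map] using hLint.det_le_one
      · simp [hi]
    · rw [det_mul, det_diagonal, Finset.prod_update_of_mem (Finset.mem_univ _)]
      simpa [mul_comm] using hdetL
    · calc _ = diagonal (Function.update 1 i₀ (σ L.det)) * (L * x * conjT σ L) *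
            conjT σ (diagonal (Function.update 1 i₀ (σ L.det))) := by
              rw [conjT_mul]; simp only [Matrix.mul_assoc]
        _ = _ := by
          rw [hLL, conjT_diagonal, diagonal_mul_diagonal, diagonal_mul_diagonal]
          congr 1
          funext i
          by_cases hi : i = i₀
          · subst hi
            simp only [Function.update_self, h.involutive]
            linear_combination (p ^ (e ∘ s) i) * hdetL
          · simp [hi]

end NormalForm

/-! ### Bounds on minors under multiplication. -/

section Minors

variable {E : Type*} [Field E] [ValuativeRel E] {ι T : Type*} [Fintype ι] [DecidableEq ι]
  [Fintype T] [DecidableEq T]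

/-- All integral combinations of the maximal minors of `C` are bounded by `r`. -/
def MinorsLE (C : Matrix ι T E) (r : ValueGroupWithZero E) : Prop :=
  ∀ A : Matrix T ι E, IsIntegralMatrix A → valuation E (A * C).det ≤ r

variable (T) in
/-- Left multiplication by `g` scales the bounds on minors of size `T` by at most `γ`. -/
def MinorBound (g : Matrix ι ι E) (γ : ValueGroupWithZero E) : Prop :=
  ∀ (C : Matrix ι T E) (r : ValueGroupWithZero E), MinorsLE C r → MinorsLE (g * C) (γ * r)

/-- Because the bound is an operator estimate over all `C`, multiplicativity is mere composition. -/
lemma MinorBound.mul {g h : Matrix ι ι E} {γ δ : ValueGroupWithZero E} (hg : MinorBound T g γ)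
    (hh : MinorBound T h δ) : MinorBound T (g * h) (γ * δ) := fun C r hC => by
  rw [Matrix.mul_assoc, mul_assoc]
  exact hg _ _ (hh _ _ hC)

lemma IsIntegralMatrix.minorBound {g : Matrix ι ι E} (hg : IsIntegralMatrix g) :
    MinorBound T g 1 := fun C r hC A hA => by
  rw [← Matrix.mul_assoc, one_mul]
  exact hC _ (hA.mul hg)

/-- Expansion of the determinant of a product along the rows of the second factor. -/
lemma det_mul_eq_sum (A : Matrix T ι E) (B : Matrix ι T E) :
    (A * B).det = ∑ f : T → ι, (∏ t, A t (f t)) * (B.submatrix f id).det := by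
  have h1 : (A * B) = fun t => ∑ i, A t i • B i := by
    funext t
    ext s
    simp [mul_apply, Finset.sum_apply]
  change detRowAlternating (A * B) = _
  rw [h1]
  rw [← AlternatingMap.coe_multilinearMap, MultilinearMap.map_sum]
  refine Finset.sum_congr rfl fun f _ => ?_
  rw [MultilinearMap.map_smul_univ]
  rfl

/-- In the expansion over row choices `f`, a non-injective `f` repeats a row and contributes zero;
the others contribute $\prod_t d_{f(t)}$ times a minor of `C`. -/
lemma minorBound_diagonal {d : ι → E} {γ : ValueGroupWithZero E}
    (hd : ∀ f : T → ι, Function.Injective f → ∏ t, valuation E (d (f t)) ≤ γ) :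
    MinorBound T (diagonal d) γ := by
  intro C r hC A hA
  rw [det_mul_eq_sum]
  refine (valuation E).map_sum_le fun f _ => ?_
  by_cases hf : Function.Injective f
  · have h1 : (diagonal d * C).submatrix f id = diagonal (d ∘ f) * C.submatrix f id := by
      ext t s
      simp [diagonal_mul]
    have h2 : C.submatrix f id = (1 : Matrix ι ι E).submatrix f id * C := by
      ext t s
      simp [mul_apply, one_apply]
    rw [h1, det_mul, det_diagonal, map_mul, map_mul, map_prod, map_prod]
    refine (mul_le_of_le_one_left' (Finset.prod_le_one' fun t _ => hA _ _)).trans ?_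
    refine mul_le_mul' (hd f hf) ?_
    rw [h2]
    exact hC _ (IsIntegralMatrix.one.submatrix _ _)
  · simp only [Function.Injective, not_forall] at hf
    obtain ⟨s, t, hst, hne⟩ := hf
    rw [det_zero_of_row_eq hne (by funext u; simp [hst]), mul_zero, map_zero]
    exact zero_le

/-- Sharpness of the diagonal bound, tested on the 0-1 matrices selecting the columns and rows `f`.
-/
lemma MinorBound.prod_le {d : ι → E} {γ : ValueGroupWithZero E}
    (hd : MinorBound T (diagonal d) γ) {f : T → ι} (hf : Function.Injective f) :
    ∏ t, valuation E (d (f t)) ≤ γ := by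
  have h1 : MinorsLE ((1 : Matrix ι ι E).submatrix id f) 1 := fun A hA =>
    (hA.mul (IsIntegralMatrix.one.submatrix _ _)).det_le_one
  have h2 := hd _ _ h1 ((1 : Matrix ι ι E).submatrix f id) (IsIntegralMatrix.one.submatrix _ _)
  have h3 : (1 : Matrix ι ι E).submatrix f id * (diagonal d * (1 : Matrix ι ι E).submatrix id f) =
      diagonal (d ∘ f) := by
    ext s t
    simp only [mul_apply, submatrix_apply, id, one_apply, diagonal_apply, Function.comp_apply]
    by_cases hst : s = t
    · subst hst; simp
    · simp [hst, hf.ne hst]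
  rw [h3, det_diagonal, mul_one, map_prod] at h2
  exact h2

end Minors

/-! ### Combinatorics of the dominance order. -/

section Dominance

variable {n : ℕ}

/-- A dominant weight has the smallest sum over the last indices. -/
lemma sum_Ioi_le_sum_of_injective {e : Fin n → ℤ} (he : Antitone e) (j : Fin n)
    {U : Finset (Fin n)} (hU : U = Finset.Ioi j) {f : U → Fin n} (hf : Function.Injective f) :
    ∑ i ∈ U, e i ≤ ∑ t, e (f t) := by
  set I := Finset.univ.image f with hI
  have hsum : ∑ t, e (f t) = ∑ i ∈ I, e i := by
    rw [hI, Finset.sum_image hf.injOn]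
  have hcard : I.card = U.card := by
    rw [hI, Finset.card_image_of_injective _ hf, Finset.card_univ, Fintype.card_coe]
  have hc : (I \ U).card = (U \ I).card := by
    have h1 := Finset.card_sdiff_add_card_inter I U
    have h2 := Finset.card_sdiff_add_card_inter U I
    rw [Finset.inter_comm] at h2
    omega
  -- Exchange argument: the two differences have equal size, and `e j` separates the values of `e`
  -- on `U` from those off `U`.
  have h1 : ∑ i ∈ U \ I, e i ≤ (U \ I).card • e j :=
    Finset.sum_le_card_nsmul _ _ _ fun i hi => he (by
      have := (Finset.mem_sdiff.1 hi).1
      rw [hU, Finset.mem_Ioi] at this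
      exact this.le)
  have h2 : (I \ U).card • e j ≤ ∑ i ∈ I \ U, e i :=
    Finset.card_nsmul_le_sum _ _ _ fun i hi => he (by
      have := (Finset.mem_sdiff.1 hi).2
      rw [hU, Finset.mem_Ioi, not_lt] at this
      exact this)
  rw [hsum, ← Finset.sum_inter_add_sum_sdiff U I, ← Finset.sum_inter_add_sum_sdiff I U,
    Finset.inter_comm I U]
  rw [hc] at h2
  linarith

lemma sum_Iic_eq_neg_sum_Ioi (l : CoweightLattice n) (j : Fin n) :
    ∑ i ∈ Finset.Iic j, l.1 i = -∑ i ∈ Finset.Ioi j, l.1 i := by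
  have h0 : ∑ i, l.1 i = 0 := l.2
  have h1 : (Finset.Iic j)ᶜ = Finset.Ioi j := by
    ext i; simp
  rw [← Finset.sum_add_sum_compl (Finset.Iic j), h1] at h0
  linarith

lemma IsPositive.antisymm {l m : CoweightLattice n} (h1 : IsPositive (l - m))
    (h2 : IsPositive (m - l)) : l = m := by
  have hz : ∀ j, ∑ i ∈ Finset.Iic j, (l.1 i - m.1 i) = 0 := by
    intro j
    have a1 := h1 j
    have a2 := h2 j
    simp only [AddSubgroup.coe_sub, Pi.sub_apply, Finset.sum_sub_distrib] at a1 a2 ⊢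
    linarith
  apply Subtype.ext
  funext j
  induction j using WellFoundedLT.induction with
  | _ j ih =>
    have := hz j
    rw [Finset.sum_eq_single j (fun i hi hij => by
      rw [ih i (lt_of_le_of_ne (Finset.mem_Iic.1 hi) hij), sub_self]) (by simp)] at this
    linarith

/-- Only finitely many dominant weights lie below a given weight. -/
lemma finite_dominant_le (l : CoweightLattice n) :
    {m : CoweightLattice n | IsDominant m ∧ IsPositive (l - m)}.Finite := by
  rcases isEmpty_or_nonempty (Fin n) with hn | hn
  · exact Set.toFinite _
  obtain ⟨i₀, hi₀⟩ : ∃ i₀ : Fin n, ∀ i, i₀ ≤ i := Finite.exists_min id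
  -- The first coordinate bounds every coordinate of `m` above by `B`; as they sum to zero, each is
  -- at least $-nB$.
  set B := |l.1 i₀|
  have hmax : ∀ m : CoweightLattice n, IsDominant m → IsPositive (l - m) → ∀ i, m.1 i ≤ B := by
    intro m hm hlm i
    have h1 := hlm i₀
    have h2 : Finset.Iic i₀ = {i₀} := by
      ext i
      simpa using ⟨fun h => le_antisymm h (hi₀ i), fun h => h.le⟩
    rw [h2, Finset.sum_singleton, AddSubgroup.coe_sub, Pi.sub_apply] at h1
    have h3 := hm (hi₀ i)
    have h4 : l.1 i₀ ≤ B := le_abs_self _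
    linarith
  refine Set.Finite.subset (Set.Finite.preimage Subtype.val_injective.injOn
    (Set.finite_Icc (fun _ : Fin n => -(n * B)) fun _ => B)) ?_
  rintro m ⟨hm, hlm⟩
  refine ⟨fun i => ?_, hmax m hm hlm⟩
  have h0 : ∑ i, m.1 i = 0 := m.2
  rw [← Finset.add_sum_erase _ _ (Finset.mem_univ i)] at h0
  have h1 : ∑ j ∈ Finset.univ.erase i, m.1 j ≤ (Finset.univ.erase i).card • B :=
    Finset.sum_le_card_nsmul _ _ _ fun j _ => hmax m hm hlm j
  have h2 : ((Finset.univ.erase i).card • B : ℤ) ≤ n * B := by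
    rw [nsmul_eq_mul]
    refine mul_le_mul_of_nonneg_right ?_ (abs_nonneg _)
    have := Finset.card_le_univ (Finset.univ.erase i)
    rw [Fintype.card_fin] at this
    exact_mod_cast this
  change -(n * B) ≤ m.1 i
  linarith

end Dominance

/-! ### From minors to dominance. -/

section Triangular

variable {F E : Type*} [Field F] [Field E] [Algebra F E] [ValuativeRel E] {n : ℕ}

lemma mem_K₀_iff {g : SL(n, E)} : g ∈ K₀ n E ↔ IsIntegralMatrix g.1 := by
  constructor
  · rintro ⟨k, rfl⟩ i j
    exact (k i j).2
  · intro hg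
    refine ⟨⟨fun i j => ⟨g.1 i j, hg i j⟩, ?_⟩, ?_⟩
    · apply Subtype.ext
      refine (RingHom.map_det (𝒪[E]).subtype _).trans ?_
      exact g.2
    · ext i j; rfl

lemma coe_piPow (ϖ : Fˣ) (l : CoweightLattice n) :
    (piPow E ϖ l).1 = diagonal fun i => algebraMap F E ϖ ^ l.1 i := rfl

variable {ϖ : Fˣ} (hϖ : IsUniformizer (algebraMap F E ϖ))
include hϖ

/-- As $|\pi|<1$, the largest minor has the smallest exponent sum, which for dominant `l` is that of
the last indices. -/
lemma minorBound_piPow {l : CoweightLattice n} (hl : IsDominant l) (j : Fin n) :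
    MinorBound (Finset.Ioi j) (piPow E ϖ l).1
      (valuation E (algebraMap F E ϖ) ^ ∑ i ∈ Finset.Ioi j, l.1 i) := by
  rw [coe_piPow]
  refine minorBound_diagonal fun f hf => ?_
  simp only [map_zpow₀]
  rw [← zpow_sum₀ hϖ.valuation_pos.ne']
  exact zpow_le_zpow_right_of_le_one₀ hϖ.valuation_pos hϖ.valuation_lt_one.le
    (sum_Ioi_le_sum_of_injective hl j rfl hf)

lemma minorBound_of_mem_doubleCoset {l : CoweightLattice n} (hl : IsDominant l) {g : SL(n, E)}
    (hg : g ∈ DoubleCoset.doubleCoset (piPow E ϖ l) (K₀ n E : Set SL(n, E)) (K₀ n E))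
    (j : Fin n) : MinorBound (Finset.Ioi j) g.1
      (valuation E (algebraMap F E ϖ) ^ ∑ i ∈ Finset.Ioi j, l.1 i) := by
  obtain ⟨a, ha, b, hb, rfl⟩ := DoubleCoset.mem_doubleCoset.1 hg
  have := ((mem_K₀_iff.1 ha).minorBound.mul (minorBound_piPow hϖ hl j)).mul
    (mem_K₀_iff.1 hb).minorBound
  rwa [one_mul, mul_one] at this

/-- Weights have total sum zero, so bounding sums over the last indices is the same as bounding
initial partial sums the other way. -/
lemma isPositive_sub_of_minorBound {l m : CoweightLattice n}
    (h : ∀ j, MinorBound (Finset.Ioi j) (piPow E ϖ m).1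
      (valuation E (algebraMap F E ϖ) ^ ∑ i ∈ Finset.Ioi j, l.1 i)) : IsPositive (l - m) := by
  intro j
  rw [sum_Iic_eq_neg_sum_Ioi]
  have h1 := h j
  rw [coe_piPow] at h1
  have h2 := h1.prod_le (f := Subtype.val) Subtype.val_injective
  simp only [map_zpow₀] at h2
  rw [← zpow_sum₀ hϖ.valuation_pos.ne', zpow_le_zpow_iff_right_of_lt_one₀ hϖ.valuation_pos
    hϖ.valuation_lt_one, Finset.sum_coe_sort (Finset.Ioi j) (fun i => m.1 i)] at h2
  simp only [AddSubgroup.coe_sub, Pi.sub_apply, Finset.sum_sub_distrib]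
  linarith

/-- A dominant weight is determined by its double coset. -/
lemma eq_of_piPow_mem_doubleCoset {l m : CoweightLattice n} (hl : IsDominant l)
    (hm : IsDominant m)
    (h : piPow E ϖ m ∈ DoubleCoset.doubleCoset (piPow E ϖ l) (K₀ n E : Set SL(n, E)) (K₀ n E)) :
    m = l := by
  have h' : piPow E ϖ l ∈
      DoubleCoset.doubleCoset (piPow E ϖ m) (K₀ n E : Set SL(n, E)) (K₀ n E) := by
    rw [DoubleCoset.doubleCoset_eq_of_mem h]
    exact DoubleCoset.mem_doubleCoset_self _ _ _
  exact (IsPositive.antisymm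
    (isPositive_sub_of_minorBound hϖ (minorBound_of_mem_doubleCoset hϖ hl h))
    (isPositive_sub_of_minorBound hϖ (minorBound_of_mem_doubleCoset hϖ hm h'))).symm

/-- Triangularity of the product of two double cosets. -/
lemma isPositive_of_mem_mul {l m r : CoweightLattice n} (hl : IsDominant l) (hm : IsDominant m)
    {g h : SL(n, E)}
    (hg : g ∈ DoubleCoset.doubleCoset (piPow E ϖ l) (K₀ n E : Set SL(n, E)) (K₀ n E))
    (hh : h ∈ DoubleCoset.doubleCoset (piPow E ϖ m) (K₀ n E : Set SL(n, E)) (K₀ n E))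
    (hgh : g * h = piPow E ϖ r) : IsPositive (l + m - r) := by
  refine isPositive_sub_of_minorBound hϖ fun j => ?_
  have := (minorBound_of_mem_doubleCoset hϖ hl hg j).mul (minorBound_of_mem_doubleCoset hϖ hm hh j)
  rw [← zpow_add₀ hϖ.valuation_pos.ne', ← Finset.sum_add_distrib] at this
  rw [← hgh]
  exact this

end Triangular

/-! ### Convolution of characteristic functions as a Haar measure. -/

section Convolution

lemma isLocallyConstant_indicator {X : Type*} [TopologicalSpace X] {s : Set X} (hs : IsClopen s) :
    IsLocallyConstant (s.indicator (1 : X → ℂ)) := by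
  rw [IsLocallyConstant.iff_eventually_eq]
  intro x
  by_cases hx : x ∈ s
  · filter_upwards [hs.isOpen.mem_nhds hx] with y hy
    simp [hx, hy]
  · filter_upwards [hs.compl.isOpen.mem_nhds hx] with y hy
    rw [Set.indicator_of_notMem hx, Set.indicator_of_notMem hy]

lemma indicator_one_eq_of_iff {X : Type*} {s : Set X} {x y : X} (h : x ∈ s ↔ y ∈ s) :
    s.indicator (1 : X → ℂ) x = s.indicator 1 y := by
  classical
  simp only [Set.indicator_apply, h, Pi.one_apply]

variable {G : Type*} [Group G] [TopologicalSpace G] [IsTopologicalGroup G]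

lemma isOpen_of_mul_mem {K : Subgroup G} (hK : IsOpen (K : Set G)) {S : Set G}
    (hS : ∀ g ∈ S, ∀ k ∈ K, g * k ∈ S) : IsOpen S := by
  rw [isOpen_iff_mem_nhds]
  intro g hg
  have h1 : (fun x => g⁻¹ * x) ⁻¹' (K : Set G) ∈ nhds g :=
    (hK.preimage (continuous_const_mul g⁻¹)).mem_nhds (by simp)
  filter_upwards [h1] with x hx
  have := hS g hg _ hx
  rwa [mul_inv_cancel_left] at this

lemma mul_mem_doubleCoset {K : Subgroup G} {a g k : G} (hk : k ∈ K)
    (hg : g ∈ DoubleCoset.doubleCoset a (K : Set G) K) :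
    g * k ∈ DoubleCoset.doubleCoset a (K : Set G) K := by
  obtain ⟨x, hx, y, hy, rfl⟩ := DoubleCoset.mem_doubleCoset.1 hg
  exact DoubleCoset.mem_doubleCoset.2 ⟨x, hx, y * k, K.mul_mem hy hk, by rw [mul_assoc _ y k]⟩

lemma mem_mul_doubleCoset {K : Subgroup G} {a g k : G} (hk : k ∈ K)
    (hg : g ∈ DoubleCoset.doubleCoset a (K : Set G) K) :
    k * g ∈ DoubleCoset.doubleCoset a (K : Set G) K := by
  obtain ⟨x, hx, y, hy, rfl⟩ := DoubleCoset.mem_doubleCoset.1 hg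
  exact DoubleCoset.mem_doubleCoset.2 ⟨k * x, K.mul_mem hk hx, y, hy, by simp only [mul_assoc]⟩

lemma mul_mem_doubleCoset_iff {K : Subgroup G} {a g k : G} (hk : k ∈ K) :
    g * k ∈ DoubleCoset.doubleCoset a (K : Set G) K ↔
      g ∈ DoubleCoset.doubleCoset a (K : Set G) K :=
  ⟨fun h => by simpa using mul_mem_doubleCoset (K.inv_mem hk) h, mul_mem_doubleCoset hk⟩

lemma mem_mul_doubleCoset_iff {K : Subgroup G} {a g k : G} (hk : k ∈ K) :
    k * g ∈ DoubleCoset.doubleCoset a (K : Set G) K ↔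
      g ∈ DoubleCoset.doubleCoset a (K : Set G) K :=
  ⟨fun h => by simpa using mem_mul_doubleCoset (K.inv_mem hk) h, mem_mul_doubleCoset hk⟩

lemma isClopen_doubleCoset {K : Subgroup G} (hK : IsOpen (K : Set G)) (a : G) :
    IsClopen (DoubleCoset.doubleCoset a (K : Set G) K) := by
  constructor
  · rw [← isOpen_compl_iff]
    exact isOpen_of_mul_mem hK fun g hg k hk h => hg ((mul_mem_doubleCoset_iff hk).1 h)
  · exact isOpen_of_mul_mem hK fun g hg k hk => mul_mem_doubleCoset hk hg

lemma isCompact_doubleCoset {K : Subgroup G} (hK : IsCompact (K : Set G)) (a : G) :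
    IsCompact (DoubleCoset.doubleCoset a (K : Set G) K) :=
  (hK.mul isCompact_singleton).mul hK

variable {X : Type*} [MulAction G X]

lemma smul_mem_orbit_of_mem {K : Subgroup G} {k : G} (hk : k ∈ K) {x y : X}
    (hx : x ∈ MulAction.orbit K y) : k • x ∈ MulAction.orbit K y := by
  obtain ⟨a, rfl⟩ := hx
  exact ⟨⟨k, hk⟩ * a, mul_smul (⟨k, hk⟩ : K) a y⟩

lemma smul_mem_orbit_iff_of_mem {K : Subgroup G} {k : G} (hk : k ∈ K) {x y : X} :
    k • x ∈ MulAction.orbit K y ↔ x ∈ MulAction.orbit K y :=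
  ⟨fun h => by simpa using smul_mem_orbit_of_mem (K.inv_mem hk) h, smul_mem_orbit_of_mem hk⟩

/-- The set over which the convolution of two characteristic functions integrates. -/
def convSet (D : Set G) (Y : Set X) (x : X) : Set G := {g | g ∈ D ∧ g⁻¹ • x ∈ Y}

lemma isOpen_convSet {K : Subgroup G} (hK : IsOpen (K : Set G)) {a : G} {Y : Set X}
    (hY : ∀ k ∈ K, ∀ y ∈ Y, k • y ∈ Y) (x : X) :
    IsOpen (convSet (DoubleCoset.doubleCoset a (K : Set G) K) Y x) :=
  isOpen_of_mul_mem hK fun g hg k hk => ⟨mul_mem_doubleCoset hk hg.1, by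
    rw [_root_.mul_inv_rev, mul_smul]
    exact hY _ (K.inv_mem hk) _ hg.2⟩

variable [MeasurableSpace G] [BorelSpace G] (ν : Measure G) [ν.IsHaarMeasure]

lemma conv_indicator {K : Subgroup G} (hK : IsOpen (K : Set G)) {a : G} {Y : Set X}
    (hY : ∀ k ∈ K, ∀ y ∈ Y, k • y ∈ Y) (x : X) :
    conv ν ((DoubleCoset.doubleCoset a (K : Set G) K).indicator 1) (Y.indicator 1) x =
      (ν.real (convSet (DoubleCoset.doubleCoset a (K : Set G) K) Y x) : ℂ) := by
  have h1 : ∀ g : G, (DoubleCoset.doubleCoset a (K : Set G) K).indicator (1 : G → ℂ) g *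
      Y.indicator (1 : X → ℂ) (g⁻¹ • x) =
      (convSet (DoubleCoset.doubleCoset a (K : Set G) K) Y x).indicator (1 : G → ℂ) g := by
    intro g
    by_cases hg : g ∈ DoubleCoset.doubleCoset a (K : Set G) K
    · by_cases hx : g⁻¹ • x ∈ Y
      · rw [Set.indicator_of_mem hg, Set.indicator_of_mem hx, Set.indicator_of_mem
          (show g ∈ convSet _ Y x from ⟨hg, hx⟩)]
        simp
      · rw [Set.indicator_of_notMem hx, Set.indicator_of_notMem
          (show g ∉ convSet _ Y x from fun h => hx h.2), mul_zero]
    · rw [Set.indicator_of_notMem hg, Set.indicator_of_notMem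
        (show g ∉ convSet _ Y x from fun h => hg h.1), zero_mul]
  unfold conv
  simp_rw [h1]
  rw [show (1 : G → ℂ) = fun _ => (1 : ℂ) from rfl,
    integral_indicator_const _ (isOpen_convSet hK hY x).measurableSet]
  simp

/-- Moving `x` by `k` left-translates the set being measured, and Haar measure is left invariant. -/
lemma conv_indicator_smul {K : Subgroup G} (hK : IsOpen (K : Set G)) {a : G} {Y : Set X}
    (hY : ∀ k ∈ K, ∀ y ∈ Y, k • y ∈ Y) {k : G} (hk : k ∈ K) (x : X) :
    conv ν ((DoubleCoset.doubleCoset a (K : Set G) K).indicator 1) (Y.indicator 1) (k • x) =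
      conv ν ((DoubleCoset.doubleCoset a (K : Set G) K).indicator 1) (Y.indicator 1) x := by
  rw [conv_indicator ν hK hY, conv_indicator ν hK hY]
  have h1 : convSet (DoubleCoset.doubleCoset a (K : Set G) K) Y (k • x) =
      (fun g => k⁻¹ * g) ⁻¹' convSet (DoubleCoset.doubleCoset a (K : Set G) K) Y x := by
    ext g
    simp only [convSet, Set.mem_preimage, Set.mem_ofPred_eq,
      mem_mul_doubleCoset_iff (K.inv_mem hk), _root_.mul_inv_rev, inv_inv, mul_smul]
  rw [h1, measureReal_def, measureReal_def, measure_preimage_mul]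

/-- A non-empty open set has positive measure; containment in a compact double coset makes that
measure finite. -/
lemma conv_indicator_ne_zero_iff {K : Subgroup G} (hK : IsOpen (K : Set G))
    (hKc : IsCompact (K : Set G)) {a : G} {Y : Set X}
    (hY : ∀ k ∈ K, ∀ y ∈ Y, k • y ∈ Y) (x : X) :
    conv ν ((DoubleCoset.doubleCoset a (K : Set G) K).indicator 1) (Y.indicator 1) x ≠ 0 ↔
      ∃ g ∈ DoubleCoset.doubleCoset a (K : Set G) K, g⁻¹ • x ∈ Y := by
  rw [conv_indicator ν hK hY, Complex.ofReal_ne_zero]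
  constructor
  · intro h
    by_contra hne
    refine h ?_
    rw [show convSet (DoubleCoset.doubleCoset a (K : Set G) K) Y x = ∅ from
      Set.eq_empty_of_forall_notMem fun g hg => hne ⟨g, hg.1, hg.2⟩, measureReal_empty]
  · rintro ⟨g, hg, hx⟩
    refine (ENNReal.toReal_pos ?_ ?_).ne'
    · exact ((isOpen_convSet hK hY x).measure_pos ν ⟨g, hg, hx⟩).ne'
    · exact ((measure_mono fun g hg => hg.1).trans_lt
        (isCompact_doubleCoset hKc a).measure_lt_top).ne

end Convolution

/-- A function that is constant on the members of a finite disjoint family of sets containing its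
support is a combination of their characteristic functions. -/
lemma eq_smul_indicator_add {X I : Type*} {C : I → Set X} {pt : I → X} {J : Set I}
    (hJ : J.Finite)
    (hdisj : ∀ i ∈ J, ∀ j ∈ J, ∀ x ∈ C i, x ∈ C j → i = j) {φ : X → ℂ}
    (hφ : ∀ i ∈ J, ∀ x ∈ C i, φ x = φ (pt i)) (hsupp : ∀ x, φ x ≠ 0 → ∃ i ∈ J, x ∈ C i)
    {κ : I} (hκ : κ ∈ J) :
    ∃ r ∈ Submodule.span ℂ {f | ∃ i, i ∈ J ∧ i ≠ κ ∧ f = (C i).indicator (1 : X → ℂ)},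
      φ = φ (pt κ) • (C κ).indicator (1 : X → ℂ) + r := by
  classical
  refine ⟨∑ i ∈ hJ.toFinset.erase κ, φ (pt i) • (C i).indicator (1 : X → ℂ),
    Submodule.sum_mem _ fun i hi => Submodule.smul_mem _ _ (Submodule.subset_span ?_), ?_⟩
  · rw [Finset.mem_erase, Set.Finite.mem_toFinset] at hi
    exact ⟨i, hi.2, hi.1, rfl⟩
  · rw [Finset.add_sum_erase _ (fun i => φ (pt i) • (C i).indicator (1 : X → ℂ))
      (hJ.mem_toFinset.2 hκ)]
    funext x
    simp only [Finset.sum_apply, Pi.smul_apply, smul_eq_mul]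
    by_cases hx : ∃ i ∈ J, x ∈ C i
    · obtain ⟨i, hi, hxi⟩ := hx
      rw [Finset.sum_eq_single i, Set.indicator_of_mem hxi, hφ i hi x hxi]
      · simp
      · intro j hj hji
        rw [Set.indicator_of_notMem fun hxj =>
          hji (hdisj j (hJ.mem_toFinset.1 hj) i hi x hxj hxi), mul_zero]
      · intro h
        exact absurd (hJ.mem_toFinset.2 hi) h
    · have h0 : φ x = 0 := by
        by_contra h
        exact hx (hsupp x h)
      rw [h0]
      refine (Finset.sum_eq_zero fun i hi => ?_).symm
      rw [Set.indicator_of_notMem fun hxi => hx ⟨i, hJ.mem_toFinset.1 hi, hxi⟩, mul_zero]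

/-! ### $K_0$ is open and compact. -/

section Topology

variable {E : Type*} [Field E] [ValuativeRel E] [TopologicalSpace E] [IsNonarchimedeanLocalField E]
  {n : ℕ}

lemma isOpen_K₀ : IsOpen (K₀ n E : Set SL(n, E)) := by
  have h1 : (K₀ n E : Set SL(n, E)) =
      ⋂ i, ⋂ j, (fun g : SL(n, E) => g.1 i j) ⁻¹' {x | valuation E x ≤ 1} := by
    ext g
    simp [mem_K₀_iff, IsIntegralMatrix]
  rw [h1]
  refine isOpen_iInter_of_finite fun i => isOpen_iInter_of_finite fun j =>
    isOpen_valuation_le_one.preimage ?_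
  exact continuous_subtype_val.matrix_elem i j

lemma isCompact_K₀ : IsCompact (K₀ n E : Set SL(n, E)) := by
  have := t2Space_of_isNonarchimedeanLocalField E
  have h1 : (K₀ n E : Set SL(n, E)) = Subtype.val ⁻¹'
      (Set.univ.pi fun _ => Set.univ.pi fun _ => {x | valuation E x ≤ 1} :
        Set (Matrix (Fin n) (Fin n) E)) := by
    ext g
    rw [SetLike.mem_coe, mem_K₀_iff]
    exact ⟨fun h i _ j _ => h i j, fun h i j => h i trivial j trivial⟩
  rw [h1]
  refine (Matrix.SpecialLinearGroup.isClosedEmbedding_val (n := Fin n) (R := E)).isCompact_preimage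
    ?_
  exact isCompact_univ_pi fun _ => isCompact_univ_pi fun _ =>
    IsNonarchimedeanLocalField.isCompact_closedBall E 1

lemma t2Space_specialLinearGroup : T2Space SL(n, E) := by
  have := t2Space_of_isNonarchimedeanLocalField E
  infer_instance

end Topology

/-! ### The product in the Hecke algebra. -/

section GroupCase

variable {F E : Type*} [Field F] [Field E] [Algebra F E] [ValuativeRel E] [TopologicalSpace E]
  [IsNonarchimedeanLocalField E] {n : ℕ} {ϖ : Fˣ}

lemma aFun_mem_heckeAlgebra (l : CoweightLattice n) : aFun E ϖ l ∈ heckeAlgebra (K₀ n E) := by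
  have := t2Space_specialLinearGroup (E := E) (n := n)
  refine ⟨isLocallyConstant_indicator (isClopen_doubleCoset isOpen_K₀ _),
    HasCompactSupport.intro (isCompact_doubleCoset isCompact_K₀ _)
      fun x hx => Set.indicator_of_notMem hx _, fun k hk g => ?_, fun k hk g => ?_⟩
  · exact indicator_one_eq_of_iff (mem_mul_doubleCoset_iff hk)
  · exact indicator_one_eq_of_iff (mul_mem_doubleCoset_iff hk)

lemma piPow_add (l m : CoweightLattice n) :
    piPow E ϖ (l + m) = piPow E ϖ l * piPow E ϖ m := by
  apply Subtype.ext
  rw [Matrix.SpecialLinearGroup.coe_mul]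
  change (piPow E ϖ (l + m)).1 = (piPow E ϖ l).1 * (piPow E ϖ m).1
  rw [coe_piPow, coe_piPow, coe_piPow, diagonal_mul_diagonal]
  congr 1
  funext i
  exact zpow_add₀ (by simp) _ _

variable (hϖ : IsUniformizer (algebraMap F E ϖ))
include hϖ

lemma exists_mem_doubleCoset (g : SL(n, E)) : ∃ l : CoweightLattice n, IsDominant l ∧
    g ∈ DoubleCoset.doubleCoset (piPow E ϖ l) (K₀ n E : Set SL(n, E)) (K₀ n E) := by
  obtain ⟨a, b, ha, hb, e, he, he0, hab⟩ := exists_cartan hϖ g.2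
  refine ⟨⟨e, he0⟩, he, ?_⟩
  let a' : SL(n, E) := ⟨a, ha.2⟩
  let b' : SL(n, E) := ⟨b, hb.2⟩
  have h1 : a' * g * b' = piPow E ϖ ⟨e, he0⟩ := Subtype.ext hab
  refine DoubleCoset.mem_doubleCoset.2 ⟨a'⁻¹, (K₀ n E).inv_mem (mem_K₀_iff.2 ha.1), b'⁻¹,
    (K₀ n E).inv_mem (mem_K₀_iff.2 hb.1), ?_⟩
  rw [← h1]
  group

lemma eq_of_mem_doubleCoset {l m : CoweightLattice n} (hl : IsDominant l) (hm : IsDominant m)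
    {g : SL(n, E)}
    (hgl : g ∈ DoubleCoset.doubleCoset (piPow E ϖ l) (K₀ n E : Set SL(n, E)) (K₀ n E))
    (hgm : g ∈ DoubleCoset.doubleCoset (piPow E ϖ m) (K₀ n E : Set SL(n, E)) (K₀ n E)) :
    l = m := by
  refine (eq_of_piPow_mem_doubleCoset hϖ hl hm ?_).symm
  rw [← DoubleCoset.doubleCoset_eq_of_mem hgl, DoubleCoset.doubleCoset_eq_of_mem hgm]
  exact DoubleCoset.mem_doubleCoset_self _ _ _

lemma exists_conv_aFun_aFun [MeasurableSpace SL(n, E)] [BorelSpace SL(n, E)]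
    (ν : Measure SL(n, E)) [ν.IsHaarMeasure] {l m : CoweightLattice n} (hl : IsDominant l)
    (hm : IsDominant m) :
    ∃ c : ℂ, c ≠ 0 ∧ ∃ r ∈ filtA E ϖ (l + m),
      conv ν (aFun E ϖ l) (aFun E ϖ m) = c • aFun E ϖ (l + m) + r := by
  set D : CoweightLattice n → Set SL(n, E) := fun l =>
    DoubleCoset.doubleCoset (piPow E ϖ l) (K₀ n E : Set SL(n, E)) (K₀ n E) with hD
  have hY : ∀ l, ∀ k ∈ K₀ n E, ∀ y ∈ D l, k • y ∈ D l := fun l k hk y hy =>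
    mem_mul_doubleCoset hk hy
  have hne := conv_indicator_ne_zero_iff ν isOpen_K₀ isCompact_K₀ (a := piPow E ϖ l) (hY m)
  have hleft := fun (k : SL(n, E)) (hk : k ∈ K₀ n E) x =>
    conv_indicator_smul ν isOpen_K₀ (a := piPow E ϖ l) (hY m) hk x
  have hright : ∀ x, ∀ k ∈ K₀ n E, conv ν (aFun E ϖ l) (aFun E ϖ m) (x * k) =
      conv ν (aFun E ϖ l) (aFun E ϖ m) x := by
    intro x k hk
    unfold conv
    congr 1
    funext g
    rw [smul_eq_mul, smul_eq_mul, ← mul_assoc, (aFun_mem_heckeAlgebra m).2.2.2 k hk]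
  have hconst : ∀ i, ∀ x ∈ D i, conv ν (aFun E ϖ l) (aFun E ϖ m) x =
      conv ν (aFun E ϖ l) (aFun E ϖ m) (piPow E ϖ i) := by
    intro i x hx
    obtain ⟨a, ha, b, hb, rfl⟩ := DoubleCoset.mem_doubleCoset.1 hx
    rw [hright _ b hb]
    exact hleft a ha _
  have hlm : IsDominant (l + m) := fun i j hij => add_le_add (hl hij) (hm hij)
  obtain ⟨r, hr, hφ⟩ := eq_smul_indicator_add (C := D) (pt := piPow E ϖ)
    (finite_dominant_le (l + m))
    (fun i hi j hj x hxi hxj => eq_of_mem_doubleCoset hϖ hi.1 hj.1 hxi hxj)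
    (fun i _ x hx => hconst i x hx)
    (by
      intro x hx
      obtain ⟨i, hi, hxi⟩ := exists_mem_doubleCoset hϖ x
      refine ⟨i, ⟨hi, ?_⟩, hxi⟩
      rw [hconst i x hxi] at hx
      obtain ⟨g, hg, hgx⟩ := (hne _).1 hx
      exact isPositive_of_mem_mul hϖ hl hm hg hgx (mul_inv_cancel_left _ _))
    (κ := l + m) ⟨hlm, fun j => by simp⟩
  refine ⟨_, ?_, r, ?_, hφ⟩
  -- $\pi^\lambda$ itself lies in the set whose measure is the leading coefficient.
  · refine (hne _).2 ⟨piPow E ϖ l, DoubleCoset.mem_doubleCoset_self _ _ _, ?_⟩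
    rw [piPow_add, smul_eq_mul, inv_mul_cancel_left]
    exact DoubleCoset.mem_doubleCoset_self _ _ _
  · refine Submodule.span_mono ?_ hr
    rintro f ⟨i, hi, hne, rfl⟩
    exact ⟨i, hi.1, ⟨hi.2, hne⟩, rfl⟩

end GroupCase

/-! ### The action on functions on the Hermitian space. -/

section HermitianCase

variable {F E : Type*} [Field F] [Field E] [Algebra F E] [ValuativeRel E] [TopologicalSpace E]
  [IsNonarchimedeanLocalField E] {n : ℕ} {ϖ : Fˣ} {τ : GaloisInvolution F E}

lemma conjTr_piPow (l : CoweightLattice n) : conjTr τ (piPow E ϖ l) = piPow E ϖ l :=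
  (xPt τ ϖ l).2

lemma val_smul (g : SL(n, E)) (x : HermSpace n τ) : (g • x).1 = g * x.1 * conjTr τ g := rfl

lemma piPow_smul_xPt (l m : CoweightLattice n) :
    piPow E ϖ l • xPt τ ϖ m = xPt τ ϖ (2 • l + m) := by
  apply Subtype.ext
  rw [val_smul, conjTr_piPow]
  change piPow E ϖ l * piPow E ϖ m * piPow E ϖ l = piPow E ϖ (2 • l + m)
  rw [← piPow_add, ← piPow_add]
  congr 1
  rw [two_nsmul, add_right_comm]

variable (h : IsUnramifiedInvolution (algebraMap F E ϖ) τ.toAlgEquiv.toRingEquiv)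
include h

lemma conjTr_mem_K₀ {k : SL(n, E)} (hk : k ∈ K₀ n E) : conjTr τ k ∈ K₀ n E := by
  rw [mem_K₀_iff] at hk ⊢
  intro i j
  exact (h.valuation_map _).trans_le (hk j i)

lemma conjTr_mem_doubleCoset {l : CoweightLattice n} {g : SL(n, E)}
    (hg : g ∈ DoubleCoset.doubleCoset (piPow E ϖ l) (K₀ n E : Set SL(n, E)) (K₀ n E)) :
    conjTr τ g ∈ DoubleCoset.doubleCoset (piPow E ϖ l) (K₀ n E : Set SL(n, E)) (K₀ n E) := by
  obtain ⟨a, ha, b, hb, rfl⟩ := DoubleCoset.mem_doubleCoset.1 hg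
  rw [conjTr_mul, conjTr_mul, conjTr_piPow, ← mul_assoc]
  exact DoubleCoset.mem_doubleCoset.2 ⟨_, conjTr_mem_K₀ h hb, _, conjTr_mem_K₀ h ha, rfl⟩

lemma exists_mem_orbit (x : HermSpace n τ) : ∃ l : CoweightLattice n, IsDominant l ∧
    x ∈ MulAction.orbit (K₀ n E) (xPt τ ϖ l) := by
  obtain ⟨a, ha, e, he, he0, hax⟩ := h.exists_normalForm x.1.2 (congrArg Subtype.val x.2)
  let a' : SL(n, E) := ⟨a, ha.2⟩
  have ha' : a' ∈ K₀ n E := mem_K₀_iff.2 ha.1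
  refine ⟨⟨e, he0⟩, he, ⟨⟨a'⁻¹, (K₀ n E).inv_mem ha'⟩, ?_⟩⟩
  change a'⁻¹ • xPt τ ϖ ⟨e, he0⟩ = x
  rw [inv_smul_eq_iff]
  exact Subtype.ext (Subtype.ext hax.symm)

/-- The orbit of `x_λ` is the trace on the space of Hermitian matrices of the double coset. -/
lemma mem_orbit_iff {l : CoweightLattice n} (hl : IsDominant l) (x : HermSpace n τ) :
    x ∈ MulAction.orbit (K₀ n E) (xPt τ ϖ l) ↔
      x.1 ∈ DoubleCoset.doubleCoset (piPow E ϖ l) (K₀ n E : Set SL(n, E)) (K₀ n E) := by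
  have key : ∀ l, x ∈ MulAction.orbit (K₀ n E) (xPt τ ϖ l) →
      x.1 ∈ DoubleCoset.doubleCoset (piPow E ϖ l) (K₀ n E : Set SL(n, E)) (K₀ n E) := by
    rintro l ⟨k, rfl⟩
    exact DoubleCoset.mem_doubleCoset.2 ⟨k, k.2, _, conjTr_mem_K₀ h k.2, rfl⟩
  refine ⟨key l, fun hx => ?_⟩
  -- The normal form puts `x` in some dominant orbit, hence in its double coset; disjointness of
  -- dominant double cosets identifies the weight.
  obtain ⟨m, hm, hxm⟩ := exists_mem_orbit h x
  rwa [eq_of_mem_doubleCoset h.isUniformizer hl hm hx (key m hxm)]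

lemma isClosedEmbedding_hermSpace_val :
    Topology.IsClosedEmbedding (Subtype.val : HermSpace n τ → SL(n, E)) := by
  have := t2Space_specialLinearGroup (E := E) (n := n)
  have hc : Continuous (conjTr τ : SL(n, E) → SL(n, E)) := by
    refine continuous_induced_rng.2 ?_
    exact continuous_matrix fun i j =>
      h.continuous.comp (continuous_subtype_val.matrix_elem j i)
  exact (isClosed_eq hc continuous_id).isClosedEmbedding_subtypeVal

lemma mFun_mem_schwartzInv {l : CoweightLattice n} (hl : IsDominant l) :
    mFun τ ϖ l ∈ schwartzInv (K₀ n E) := by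
  have hval := isClosedEmbedding_hermSpace_val (n := n) h
  have := t2Space_specialLinearGroup (E := E) (n := n)
  have : T2Space (HermSpace n τ) := hval.isEmbedding.t2Space
  have h1 : MulAction.orbit (K₀ n E) (xPt τ ϖ l) = Subtype.val ⁻¹'
      DoubleCoset.doubleCoset (piPow E ϖ l) (K₀ n E : Set SL(n, E)) (K₀ n E) :=
    Set.ext (mem_orbit_iff h hl)
  refine ⟨isLocallyConstant_indicator ?_, HasCompactSupport.intro
    (K := MulAction.orbit (K₀ n E) (xPt τ ϖ l)) ?_ fun x hx => Set.indicator_of_notMem hx _,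
    fun k hk x => ?_⟩
  · rw [h1]
    exact (isClopen_doubleCoset isOpen_K₀ _).preimage hval.continuous
  · rw [h1]
    exact hval.isCompact_preimage (isCompact_doubleCoset isCompact_K₀ _)
  · exact indicator_one_eq_of_iff (smul_mem_orbit_iff_of_mem hk)

lemma exists_conv_aFun_mFun [MeasurableSpace SL(n, E)] [BorelSpace SL(n, E)]
    (ν : Measure SL(n, E)) [ν.IsHaarMeasure] {l m : CoweightLattice n} (hl : IsDominant l)
    (hm : IsDominant m) :
    ∃ c : ℂ, c ≠ 0 ∧ ∃ d ∈ filtM τ ϖ (2 • l + m),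
      conv ν (aFun E ϖ l) (mFun τ ϖ m) = c • mFun τ ϖ (2 • l + m) + d := by
  have hϖ := h.isUniformizer
  set C : CoweightLattice n → Set (HermSpace n τ) := fun l =>
    MulAction.orbit (K₀ n E) (xPt τ ϖ l) with hC
  have hY : ∀ l, ∀ k ∈ K₀ n E, ∀ y ∈ C l, k • y ∈ C l := fun l k hk y hy =>
    smul_mem_orbit_of_mem hk hy
  have hne := conv_indicator_ne_zero_iff ν isOpen_K₀ isCompact_K₀ (a := piPow E ϖ l) (hY m)
  have hconst : ∀ i, ∀ x ∈ C i, conv ν (aFun E ϖ l) (mFun τ ϖ m) x =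
      conv ν (aFun E ϖ l) (mFun τ ϖ m) (xPt τ ϖ i) := by
    rintro i _ ⟨k, rfl⟩
    exact conv_indicator_smul ν isOpen_K₀ (hY m) k.2 _
  have hsum : 2 • l + m = l + m + l := by rw [two_nsmul, add_right_comm]
  have hlm : IsDominant (2 • l + m) := by
    rw [hsum]
    exact fun i j hij => add_le_add (add_le_add (hl hij) (hm hij)) (hl hij)
  obtain ⟨r, hr, hφ⟩ := eq_smul_indicator_add (C := C) (pt := xPt τ ϖ)
    (finite_dominant_le (2 • l + m))
    (fun i hi j hj x hxi hxj => eq_of_mem_doubleCoset hϖ hi.1 hj.1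
      ((mem_orbit_iff h hi.1 x).1 hxi) ((mem_orbit_iff h hj.1 x).1 hxj))
    (fun i _ x hx => hconst i x hx)
    (by
      intro x hx
      obtain ⟨i, hi, hxi⟩ := exists_mem_orbit h x
      refine ⟨i, ⟨hi, ?_⟩, hxi⟩
      rw [hconst i x hxi] at hx
      obtain ⟨g, hg, hgx⟩ := (hne _).1 hx
      rw [hC, mem_orbit_iff h hm] at hgx
      -- The outer factors both have type `l` and the middle one type `m`, which is the source of
      -- $2\lambda+\mu$.
      have hprod : g * (g⁻¹ • xPt τ ϖ i).1 * conjTr τ g = piPow E ϖ i := by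
        rw [← val_smul, smul_inv_smul]
        rfl
      refine isPositive_sub_of_minorBound hϖ fun j => ?_
      have hb := ((minorBound_of_mem_doubleCoset hϖ hl hg j).mul
        (minorBound_of_mem_doubleCoset hϖ hm hgx j)).mul
        (minorBound_of_mem_doubleCoset hϖ hl (conjTr_mem_doubleCoset h hg) j)
      rw [← zpow_add₀ hϖ.valuation_pos.ne', ← zpow_add₀ hϖ.valuation_pos.ne',
        ← Finset.sum_add_distrib, ← Finset.sum_add_distrib] at hb
      rw [← hprod, hsum]
      exact hb)
    (κ := 2 • l + m) ⟨hlm, fun j => by simp⟩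
  refine ⟨_, ?_, r, ?_, hφ⟩
  · refine (hne _).2 ⟨piPow E ϖ l, DoubleCoset.mem_doubleCoset_self _ _ _, ?_⟩
    rw [← piPow_smul_xPt, inv_smul_smul]
    exact MulAction.mem_orbit_self _
  · refine Submodule.span_mono ?_ hr
    rintro f ⟨i, hi, hne, rfl⟩
    exact ⟨i, hi.1, ⟨hi.2, hne⟩, rfl⟩

end HermitianCase

lemma isUnramifiedInvolution_of_unramified {F E : Type*}
    [Field F] [ValuativeRel F] [TopologicalSpace F] [IsNonarchimedeanLocalField F]
    [Field E] [ValuativeRel E] [TopologicalSpace E] [IsNonarchimedeanLocalField E]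
    [Algebra F E] [ValuativeExtension F E] (hdeg : Module.finrank F E = 2)
    (τ : GaloisInvolution F E) {p : F} (hp : IsUniformizer p)
    (hpE : IsUniformizer (algebraMap F E p)) :
    IsUnramifiedInvolution (algebraMap F E p) τ.toAlgEquiv.toRingEquiv := by
  have hc := continuous_algEquiv hp hpE hdeg τ.toAlgEquiv
  have hfix : τ.toAlgEquiv.toRingEquiv (algebraMap F E p) = algebraMap F E p :=
    τ.toAlgEquiv.commutes p
  refine ⟨hpE, hfix, τ.involutive, ?_, hc, fun x => valuation_ringEquiv hpE _ hfix hc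
    (continuous_algEquiv hp hpE hdeg τ.toAlgEquiv.symm) x⟩
  by_contra! hcon
  exact τ.ne_one (AlgEquiv.ext hcon)

end HermitianHecke
end

open HermitianHecke in
theorem mainTheorem3
    (n : ℕ) {F E : Type*}
    [Field F] [ValuativeRel F] [TopologicalSpace F] [IsNonarchimedeanLocalField F]
    [Field E] [ValuativeRel E] [TopologicalSpace E] [IsNonarchimedeanLocalField E]
    [Algebra F E] [ValuativeExtension F E]
    (hchar : (2 : F) ≠ 0)
    (hdeg : Module.finrank F E = 2)
    (hunr : IsUnramifiedExtension F E)
    (τ : GaloisInvolution F E)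
    (ϖ : Fˣ) (hϖ : IsUniformizer (ϖ : F))
    [MeasurableSpace SL(n, E)] [BorelSpace SL(n, E)]
    (ν : Measure SL(n, E)) [ν.IsHaarMeasure]
    (l m : CoweightLattice n) (hl : IsDominant l) (hm : IsDominant m) :
    aFun E ϖ l ∈ heckeAlgebra (K₀ n E) ∧
    mFun τ ϖ m ∈ schwartzInv (K₀ n E) ∧
    (∃ p : ℂ, p ≠ 0 ∧ ∃ r ∈ filtA E ϖ (l + m),
      conv ν (aFun E ϖ l) (aFun E ϖ m) = p • aFun E ϖ (l + m) + r) ∧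
    (∃ q : ℂ, q ≠ 0 ∧ ∃ d ∈ filtM τ ϖ (2 • l + m),
      conv ν (aFun E ϖ l) (mFun τ ϖ m) = q • mFun τ ϖ (2 • l + m) + d) := by
  have h := isUnramifiedInvolution_of_unramified hdeg τ hϖ (hunr ϖ hϖ)
  exact ⟨aFun_mem_heckeAlgebra l, mFun_mem_schwartzInv h hm,
    exists_conv_aFun_aFun h.isUniformizer ν hl hm, exists_conv_aFun_mFun h ν hl hm⟩
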